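/- For $E \subset \mathbb{N}_0=\{0,1,2,\dots\}$ put $$\underline{d}(E) = \liminf_{n\to\infty} \frac{\#(E\cap[0,n])}{n},\quad \overline{d}(E) = \limsup_{n\to\infty} \frac{\#(E\cap[0,n])}{n},\quad \overline{b}(E) = \lim_{s\to\infty}\limsup_{k\to\infty} \frac{\#(E\cap[k+1,k+s])}{s}.$$ Let $T$ be a bounded linear operator on a complex Banach space $X$. For $x\in X$ and $U\subset X$ put $N(x,U)=\{n\in\mathbb{N}_0 : \lambda T^n x\in U \text{ for some } \lambda\in\mathbb{C}\}$. The operator $T$ is called frequently supercyclic (resp. $\mathscr{U}$-frequently supercyclic, reiteratively supercyclic) if there is $x\in X$ such that $\underline{d}(N(x,U))>0$ (resp. $\overline{d}(N(x,U))>0$, $\overline{b}(N(x,U))>0$) for every non-empty open $U\subset X$; it is called supercyclic if there is $x \in X$ such that $\{\lambda T^n x:\lambda\in\mathbb{C},\,n\in\mathbb{N}_0\}$ is dense in $X$. On every complex Banach space one has the inclusions $$\{\text{frequently supercyclic}\}\subset\{\mathscr{U}\text{-frequently supercyclic}\}\subset\{\text{reiteratively supercyclic}\}\subset\{\text{supercyclic}\}.$$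 All of these inclusions can be strict. For a Banach space $Z$, let $Z\oplus\mathbb{C}$ carry the norm $\|(x,z)\|=\|x\|+|z|$, and for an operator $B$ on $Z$ let $(B\oplus \mathrm{Id}_{\mathbb{C}})(x,z)=(Bx,z)$. For a bounded sequence $\mathbf{w}=(w_n)_{n\ge1}$ of positive numbers let $B_{\mathbf{w}}$ denote the weighted backward shift $(x_n)_{n\ge1}\mapsto(w_n x_{n+1})_{n\ge1}$. Then: (A) there is $\mathbf{w}$ such that $T=B_{\mathbf{w}}\oplus\mathrm{Id}_{\mathbb{C}}$ on $c_0(\mathbb{N})\oplus\mathbb{C}$ is $\mathscr{U}$-frequently supercyclic but not frequently supercyclic; (B) there is $\mathbf{w}$ such that $T=B_{\mathbf{w}}\oplus\mathrm{Id}_{\mathbb{C}}$ on $c_0(\mathbb{N})\oplus\mathbb{C}$ is reiteratively supercyclic but not $\mathscr{U}$-frequently supercyclic; (C) for every $1\le p<\infty$ there is $\mathbf{w}$ such that $T=B_{\mathbf{w}}\oplus\mathrm{Id}_{\mathbb{C}}$ on $\ell_p(\mathbb{N})\oplus\mathbb{C}$ is supercyclic but not reiteratively supercyclic. -/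

import Mathlib

open Filter Topology
open scoped ZeroAtInfty

noncomputable section

namespace LinearDynamics

/-! ### Densities of sets of nonnegative integers -/

/-- Lower asymptotic density `liminf_{n → ∞} #(E ∩ [0, n]) / n`. -/
def lowerDensity (E : Set ℕ) : ℝ :=
  liminf (fun n : ℕ => ((E ∩ Set.Icc 0 n).ncard : ℝ) / n) atTop

/-- Upper asymptotic density `limsup_{n → ∞} #(E ∩ [0, n]) / n`. -/
def upperDensity (E : Set ℕ) : ℝ :=
  limsup (fun n : ℕ => ((E ∩ Set.Icc 0 n).ncard : ℝ) / n) atTop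

/-- `limsup_{k → ∞} #(E ∩ [k + 1, k + s]) / s`. -/
def windowDensity (E : Set ℕ) (s : ℕ) : ℝ :=
  limsup (fun k : ℕ => ((E ∩ Set.Icc (k + 1) (k + s)).ncard : ℝ) / s) atTop

/-- Upper Banach density `lim_{s → ∞} limsup_{k → ∞} #(E ∩ [k + 1, k + s]) / s`.
The limit always exists, see `tendsto_windowDensity`. -/
def upperBanachDensity (E : Set ℕ) : ℝ :=
  limUnder atTop (windowDensity E)

lemma windowCount_le (E : Set ℕ) (s k : ℕ) :
    ((E ∩ Set.Icc (k + 1) (k + s)).ncard : ℝ) ≤ s := by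
  have h : (E ∩ Set.Icc (k + 1) (k + s)).ncard ≤ (Set.Icc (k + 1) (k + s)).ncard :=
    Set.ncard_le_ncard Set.inter_subset_right (Set.finite_Icc _ _)
  have h2 : (Set.Icc (k + 1) (k + s)).ncard = s := by
    rw [← Finset.coe_Icc, Set.ncard_coe_finset, Nat.card_Icc]
    omega
  exact_mod_cast h2 ▸ h

lemma windowCount_bdd_above (E : Set ℕ) (s t : ℕ) :
    IsBoundedUnder (· ≤ ·) atTop
      (fun k : ℕ => ((E ∩ Set.Icc (k + t + 1) (k + t + s)).ncard : ℝ)) :=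
  isBoundedUnder_of ⟨s, fun k => windowCount_le E s (k + t)⟩

lemma windowCount_bdd_below (E : Set ℕ) (s t : ℕ) :
    IsBoundedUnder (· ≥ ·) atTop
      (fun k : ℕ => ((E ∩ Set.Icc (k + t + 1) (k + t + s)).ncard : ℝ)) :=
  isBoundedUnder_of ⟨0, fun _ => Nat.cast_nonneg _⟩

lemma windowDensity_eq (E : Set ℕ) (s : ℕ) :
    windowDensity E s =
      limsup (fun k : ℕ => ((E ∩ Set.Icc (k + 1) (k + s)).ncard : ℝ)) atTop / s := by
  have hm : Monotone (fun x : ℝ => x / (s : ℝ)) := fun a b h =>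
    div_le_div_of_nonneg_right h (Nat.cast_nonneg s)
  exact (hm.map_limsup_of_continuousAt (F := atTop)
    (fun k : ℕ => ((E ∩ Set.Icc (k + 1) (k + s)).ncard : ℝ))
    (continuous_id.div_const _).continuousAt
    (windowCount_bdd_above E s 0)
    (windowCount_bdd_below E s 0).isCoboundedUnder_le).symm

lemma subadditive_windowCount (E : Set ℕ) :
    Subadditive (fun s : ℕ =>
      limsup (fun k : ℕ => ((E ∩ Set.Icc (k + 1) (k + s)).ncard : ℝ)) atTop) := by
  intro m n
  have hshift : limsup (fun k : ℕ => ((E ∩ Set.Icc (k + 1) (k + n)).ncard : ℝ)) atTop =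
      limsup (fun k : ℕ => ((E ∩ Set.Icc (k + m + 1) (k + m + n)).ncard : ℝ)) atTop :=
    (limsup_nat_add (fun k : ℕ => ((E ∩ Set.Icc (k + 1) (k + n)).ncard : ℝ)) m).symm
  simp only
  rw [hshift]
  refine le_trans (limsup_le_limsup (Eventually.of_forall fun k => ?_)
    (windowCount_bdd_below E (m + n) 0).isCoboundedUnder_le
    (isBoundedUnder_le_add (windowCount_bdd_above E m 0) (windowCount_bdd_above E n m)))
    (limsup_add_le (windowCount_bdd_below E m 0) (windowCount_bdd_above E m 0)
      (windowCount_bdd_below E n m).isCoboundedUnder_le (windowCount_bdd_above E n m))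
  have h : E ∩ Set.Icc (k + 1) (k + (m + n)) ⊆
      (E ∩ Set.Icc (k + 1) (k + m)) ∪ (E ∩ Set.Icc (k + m + 1) (k + m + n)) := by
    rintro x ⟨hx, h1, h2⟩
    by_cases hxm : x ≤ k + m
    · exact Or.inl ⟨hx, h1, hxm⟩
    · exact Or.inr ⟨hx, by omega, by omega⟩
  have hf : ((E ∩ Set.Icc (k + 1) (k + m)) ∪
      (E ∩ Set.Icc (k + m + 1) (k + m + n))).Finite :=
    ((Set.finite_Icc _ _).inter_of_right _).union ((Set.finite_Icc _ _).inter_of_right _)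
  have hc := (Set.ncard_le_ncard h hf).trans (Set.ncard_union_le _ _)
  simp only [Pi.add_apply, add_zero]
  exact_mod_cast hc

/-- The limit in the definition of the upper Banach density exists. -/
theorem tendsto_windowDensity (E : Set ℕ) :
    Tendsto (windowDensity E) atTop (𝓝 (upperBanachDensity E)) := by
  refine tendsto_nhds_limUnder ⟨(subadditive_windowCount E).lim, ?_⟩
  have h := (subadditive_windowCount E).tendsto_lim ⟨0, by
    rintro _ ⟨s, rfl⟩
    exact div_nonneg (le_limsup_of_frequently_le
      (Frequently.of_forall fun _ => Nat.cast_nonneg _) (windowCount_bdd_above E s 0))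
      (Nat.cast_nonneg _)⟩
  exact h.congr fun s => (windowDensity_eq E s).symm

/-! ### Dynamical notions -/

section Dynamics

variable {X : Type*} [NormedAddCommGroup X] [NormedSpace ℂ X]

/-- The return set `{n : T^n (Γ x) ∩ U ≠ ∅}`, where `Γ x = {λ x : λ ∈ Γ}`. -/
def returnSet (T : X →L[ℂ] X) (Γ : Set ℂ) (x : X) (U : Set X) : Set ℕ :=
  {n : ℕ | (((T ^ n : X →L[ℂ] X) '' ((fun c : ℂ => c • x) '' Γ)) ∩ U).Nonempty}

/-- `T` is `𝓕_Γ`-hypercyclic: for some vector `x`, the return set of `Γ x` to every non-empty open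
set belongs to the family `𝓕` of sets of nonnegative integers. -/
def IsFamilyHypercyclic (𝓕 : Set (Set ℕ)) (Γ : Set ℂ) (T : X →L[ℂ] X) : Prop :=
  ∃ x : X, ∀ U : Set X, IsOpen U → U.Nonempty → returnSet T Γ x U ∈ 𝓕

/-- Frequently supercyclic operators. -/
def IsFrequentlySupercyclic (T : X →L[ℂ] X) : Prop :=
  IsFamilyHypercyclic {E | 0 < lowerDensity E} Set.univ T

/-- `𝓤`-frequently supercyclic operators. -/
def IsUFrequentlySupercyclic (T : X →L[ℂ] X) : Prop :=
  IsFamilyHypercyclic {E | 0 < upperDensity E} Set.univ T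

/-- Reiteratively supercyclic operators. -/
def IsReiterativelySupercyclic (T : X →L[ℂ] X) : Prop :=
  IsFamilyHypercyclic {E | 0 < upperBanachDensity E} Set.univ T

/-- Supercyclic operators: some projective orbit `{c T^n x : c ∈ ℂ, n ≥ 0}` is dense. -/
def IsSupercyclic (T : X →L[ℂ] X) : Prop :=
  ∃ x : X, Dense {y : X | ∃ (c : ℂ) (n : ℕ), y = c • (T ^ n) x}

end Dynamics

/-! ### The spaces and operators -/

/-- The space `X ⊕ ℂ`, with norm `‖(x, z)‖ = ‖x‖ + |z|`. -/
abbrev SumC (X : Type*) : Type _ := WithLp 1 (X × ℂ)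

/-- The operator `B ⊕ Id_ℂ : (x, z) ↦ (B x, z)` on `X ⊕ ℂ`. -/
def sumId {X : Type*} [NormedAddCommGroup X] [NormedSpace ℂ X] (B : X →L[ℂ] X) :
    SumC X →L[ℂ] SumC X :=
  (WithLp.prodContinuousLinearEquiv 1 ℂ X ℂ).symm.toContinuousLinearMap ∘L
    (B.prodMap (ContinuousLinearMap.id ℂ ℂ)) ∘L
      (WithLp.prodContinuousLinearEquiv 1 ℂ X ℂ).toContinuousLinearMap

/-- The space `c₀(ℕ)` of complex null sequences with the supremum norm. -/
abbrev cZero : Type := C₀(ℕ, ℂ)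

/-- The space `ℓ_p(ℕ)` of complex `p`-summable sequences. -/
abbrev ellP (p : ENNReal) : Type := lp (fun _ : ℕ => ℂ) p

/-- `w` is a bounded sequence of positive numbers. Sequences are indexed from `0`. -/
def IsWeight (w : ℕ → ℝ) : Prop :=
  (∀ n, 0 < w n) ∧ BddAbove (Set.range w)

/-- `B` is the unilateral weighted backward shift on `c₀(ℕ)` with weight sequence `w`. -/
def IsBackwardShiftCZero (w : ℕ → ℝ) (B : cZero →L[ℂ] cZero) : Prop :=
  ∀ (x : cZero) (n : ℕ), B x n = (w n : ℂ) * x (n + 1)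

/-- `B` is the unilateral weighted backward shift on `ℓ_p(ℕ)` with weight sequence `w`. -/
def IsBackwardShiftEllP {p : ENNReal} [Fact (1 ≤ p)] (w : ℕ → ℝ)
    (B : ellP p →L[ℂ] ellP p) : Prop :=
  ∀ (x : ellP p) (n : ℕ), B x n = (w n : ℂ) * x (n + 1)

end LinearDynamics

end

open LinearDynamics

universe u

namespace LinearDynamics

open scoped Nat

/-! ### Densities -/

/-! The inclusions compare densities: lower ≤ upper ≤ upper Banach, and a set of positive upper
Banach density is non-empty.

For the examples, the identity summand pins down the scalar: if `c • T^n (x, z)` is close to a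
vector with non-zero second coordinate, then `c` is essentially prescribed. Hence each
supercyclicity notion for `B ⊕ Id` is the corresponding hypercyclicity notion for `B`
(`isFamilyHypercyclic_sumId_iff`), and it remains to separate the latter by weighted shifts. The
weights are chosen so that `(B^n x)_k = 2^(f (n + k) - f k) x_(n + k)`, where the exponent `f` is
large at prescribed places and grows by at most one per step.

On `c₀`, a return of `x` near a vector with first coordinate 1 forces `f n` to be large, since `x_n
→ 0`. Making `f` large mainly on zones therefore confines return sets to the zones, up to small
density (`eventually_ncard_returns_le`). Conversely, repeating a finite block periodically on each
zone gives a vector that visits every ball along full periodic subsets of infinitely many zones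
(`exists_vector_visiting_zones`). The repetitions are harmless because `f` is also large near
multiples of the periods, and these periods grow so fast that this costs little density. Zones
`[(2l+2)!, (2l+3)!]` have positive upper but zero lower density, which gives (A). Zones `[(2l+2)!,
(2l+2)! + (2l+1)!]` have zero density but contain arbitrarily long intervals, which gives (B).

On `ℓ_p`, `f` is positive only shortly before, or at, fourth powers. A Baire argument gives a dense
orbit (`exists_dense_orbit`). Two returns `n < m` near the first unit vector force `f (m - n) > 0`,
so a window of length `M^4` holds only `O(M^2)` returns, and the Banach density vanishes
(`upperBanachDensity_le_zero_of_differences`). -/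

lemma ncard_inter_Icc_mono {E F : Set ℕ} (h : E ⊆ F) (a b : ℕ) :
    (E ∩ Set.Icc a b).ncard ≤ (F ∩ Set.Icc a b).ncard :=
  Set.ncard_le_ncard (Set.inter_subset_inter_left _ h) ((Set.finite_Icc _ _).inter_of_right _)

lemma ncard_inter_Icc_zero_le (E : Set ℕ) (n : ℕ) : (E ∩ Set.Icc 0 n).ncard ≤ n + 1 := by
  have h := Set.ncard_le_ncard (Set.inter_subset_right (s := E) (t := Set.Icc 0 n))
    (Set.finite_Icc _ _)
  rwa [← Finset.coe_Icc 0 n, Set.ncard_coe_finset, Nat.card_Icc, Finset.coe_Icc] at h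

lemma count_div_le_two (E : Set ℕ) (n : ℕ) : ((E ∩ Set.Icc 0 n).ncard : ℝ) / n ≤ 2 := by
  rcases Nat.eq_zero_or_pos n with rfl | hn
  · simp
  · rw [div_le_iff₀ (by exact_mod_cast hn)]
    have := ncard_inter_Icc_zero_le E n
    exact_mod_cast (by omega : _ ≤ 2 * n)

lemma count_div_bdd_above (E : Set ℕ) :
    IsBoundedUnder (· ≤ ·) atTop (fun n : ℕ => ((E ∩ Set.Icc 0 n).ncard : ℝ) / n) :=
  isBoundedUnder_of ⟨2, count_div_le_two E⟩

lemma count_div_bdd_below (E : Set ℕ) :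
    IsBoundedUnder (· ≥ ·) atTop (fun n : ℕ => ((E ∩ Set.Icc 0 n).ncard : ℝ) / n) :=
  isBoundedUnder_of ⟨0, fun _ => by positivity⟩

lemma windowCount_div_bdd_above (E : Set ℕ) (s : ℕ) : IsBoundedUnder (· ≤ ·) atTop
    (fun k : ℕ => ((E ∩ Set.Icc (k + 1) (k + s)).ncard : ℝ) / s) :=
  isBoundedUnder_of ⟨1, fun k => div_le_one_of_le₀ (windowCount_le E s k) (Nat.cast_nonneg _)⟩

lemma windowCount_div_bdd_below (E : Set ℕ) (s : ℕ) : IsBoundedUnder (· ≥ ·) atTop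
    (fun k : ℕ => ((E ∩ Set.Icc (k + 1) (k + s)).ncard : ℝ) / s) :=
  isBoundedUnder_of ⟨0, fun _ => by positivity⟩

lemma lowerDensity_mono {E F : Set ℕ} (h : E ⊆ F) : lowerDensity E ≤ lowerDensity F :=
  liminf_le_liminf (Eventually.of_forall fun n => by
    exact div_le_div_of_nonneg_right (Nat.cast_le.2 (ncard_inter_Icc_mono h 0 n))
      (Nat.cast_nonneg n)) (count_div_bdd_below E) (count_div_bdd_above F).isCoboundedUnder_ge

lemma upperDensity_mono {E F : Set ℕ} (h : E ⊆ F) : upperDensity E ≤ upperDensity F :=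
  limsup_le_limsup (Eventually.of_forall fun n => by
    exact div_le_div_of_nonneg_right (Nat.cast_le.2 (ncard_inter_Icc_mono h 0 n))
      (Nat.cast_nonneg n)) (count_div_bdd_below E).isCoboundedUnder_le (count_div_bdd_above F)

lemma upperBanachDensity_mono {E F : Set ℕ} (h : E ⊆ F) :
    upperBanachDensity E ≤ upperBanachDensity F :=
  le_of_tendsto_of_tendsto' (tendsto_windowDensity E) (tendsto_windowDensity F) fun s =>
    limsup_le_limsup (Eventually.of_forall fun n => by
      exact div_le_div_of_nonneg_right
        (Nat.cast_le.2 (ncard_inter_Icc_mono h (n + 1) (n + s))) (Nat.cast_nonneg s)) (windowCount_div_bdd_below E s).isCoboundedUnder_le (windowCount_div_bdd_above F s)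

lemma lowerDensity_le_upperDensity (E : Set ℕ) : lowerDensity E ≤ upperDensity E :=
  liminf_le_limsup (count_div_bdd_above E) (count_div_bdd_below E)

lemma le_upperDensity_of_frequently {E : Set ℕ} {c : ℝ}
    (h : ∃ᶠ n : ℕ in atTop, c * n ≤ ((E ∩ Set.Icc 0 n).ncard : ℝ)) : c ≤ upperDensity E := by
  refine le_limsup_of_frequently_le ?_ (count_div_bdd_above E)
  refine (h.and_eventually (eventually_gt_atTop 0)).mono fun n hn => ?_
  rw [le_div_iff₀ (by exact_mod_cast hn.2)]
  exact hn.1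

lemma upperDensity_le_of_eventually {E : Set ℕ} {c : ℝ}
    (h : ∀ᶠ n : ℕ in atTop, ((E ∩ Set.Icc 0 n).ncard : ℝ) ≤ c * n) : upperDensity E ≤ c := by
  refine limsup_le_of_le (count_div_bdd_below E).isCoboundedUnder_le ?_
  filter_upwards [h, eventually_gt_atTop 0] with n hn h0
  rw [div_le_iff₀ (by exact_mod_cast h0)]
  exact hn

lemma lowerDensity_le_of_frequently {E : Set ℕ} {c : ℝ}
    (h : ∃ᶠ n : ℕ in atTop, ((E ∩ Set.Icc 0 n).ncard : ℝ) ≤ c * n) : lowerDensity E ≤ c := by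
  refine liminf_le_of_frequently_le ?_ (count_div_bdd_below E)
  refine (h.and_eventually (eventually_gt_atTop 0)).mono fun n hn => ?_
  rw [div_le_iff₀ (by exact_mod_cast hn.2)]
  exact hn.1

lemma le_upperBanachDensity {E : Set ℕ} {c : ℝ}
    (h : ∀ᶠ s : ℕ in atTop, ∃ᶠ k : ℕ in atTop,
      c * s ≤ ((E ∩ Set.Icc (k + 1) (k + s)).ncard : ℝ)) : c ≤ upperBanachDensity E := by
  refine ge_of_tendsto (tendsto_windowDensity E) ?_
  filter_upwards [h, eventually_gt_atTop 0] with s hs h0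
  refine le_limsup_of_frequently_le (hs.mono fun k hk => ?_) (windowCount_div_bdd_above E s)
  rw [le_div_iff₀ (by exact_mod_cast h0)]
  exact hk

lemma eventually_frequently_of_lt_upperBanachDensity {E : Set ℕ} {c : ℝ}
    (h : c < upperBanachDensity E) :
    ∀ᶠ s : ℕ in atTop, ∃ᶠ k : ℕ in atTop,
      c * s < ((E ∩ Set.Icc (k + 1) (k + s)).ncard : ℝ) := by
  filter_upwards [(tendsto_windowDensity E).eventually_const_lt h, eventually_gt_atTop 0]
    with s hs h0
  refine (frequently_lt_of_lt_limsup (windowCount_div_bdd_below E s).isCoboundedUnder_le hs).mono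
    fun k hk => ?_
  rwa [lt_div_iff₀ (by exact_mod_cast h0)] at hk

/-- For `c` above the Banach density, some fixed length `s` has all late windows containing fewer
than `c * s` elements. Tiling `[0, n]` by an initial piece and such windows bounds its count by `c *
n + O(1)`. -/
lemma upperDensity_le_upperBanachDensity (E : Set ℕ) : upperDensity E ≤ upperBanachDensity E := by
  refine le_of_forall_gt_imp_ge_of_dense fun c hc => ?_
  obtain ⟨s, hs, h0⟩ := (((tendsto_windowDensity E).eventually_lt_const hc).and
    (eventually_gt_atTop 0)).exists
  have hs0 : (0 : ℝ) < s := by exact_mod_cast h0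
  obtain ⟨K, hK⟩ := eventually_atTop.1
    (eventually_lt_of_limsup_lt hs (windowCount_div_bdd_above E s))
  have hblock : ∀ i : ℕ, ((E ∩ Set.Icc 0 (K + i * s)).ncard : ℝ) ≤ K + 1 + i * (c * s) := by
    intro i
    induction i with
    | zero => simpa using (by exact_mod_cast ncard_inter_Icc_zero_le E K :
        ((E ∩ Set.Icc 0 K).ncard : ℝ) ≤ K + 1)
    | succ i ih =>
      have h1 : E ∩ Set.Icc 0 (K + (i + 1) * s) ⊆ (E ∩ Set.Icc 0 (K + i * s)) ∪
          (E ∩ Set.Icc (K + i * s + 1) (K + i * s + s)) := by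
        rintro x ⟨hx, -, h2⟩
        by_cases hxm : x ≤ K + i * s
        · exact Or.inl ⟨hx, Nat.zero_le _, hxm⟩
        · refine Or.inr ⟨hx, by omega, ?_⟩
          rw [add_mul] at h2
          omega
      have h2 := (Set.ncard_le_ncard h1 (((Set.finite_Icc _ _).inter_of_right _).union
        ((Set.finite_Icc _ _).inter_of_right _))).trans (Set.ncard_union_le _ _)
      have h3 := hK (K + i * s) (by omega)
      rw [div_lt_iff₀ hs0] at h3
      have h4 : ((E ∩ Set.Icc 0 (K + (i + 1) * s)).ncard : ℝ) ≤ (E ∩ Set.Icc 0 (K + i * s)).ncard +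
          (E ∩ Set.Icc (K + i * s + 1) (K + i * s + s)).ncard := by exact_mod_cast h2
      push_cast
      linarith
  have hc0 : 0 ≤ c := by
    have := hK K le_rfl
    have h1 : (0 : ℝ) ≤ ((E ∩ Set.Icc (K + 1) (K + s)).ncard : ℝ) / s := by positivity
    linarith
  refine le_of_forall_pos_le_add fun ε hε => upperDensity_le_of_eventually ?_
  have hlim : ∀ᶠ n : ℕ in atTop, (K + 1 + c * s) / ε ≤ (n : ℝ) :=
    tendsto_natCast_atTop_atTop.eventually_ge_atTop _
  filter_upwards [hlim] with n hn
  rw [div_le_iff₀ hε] at hn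
  have h1 : E ∩ Set.Icc 0 n ⊆ E ∩ Set.Icc 0 (K + (n / s + 1) * s) := by
    refine Set.inter_subset_inter_right _ (Set.Icc_subset_Icc_right ?_)
    have := Nat.lt_div_mul_add h0 (a := n)
    rw [add_mul]
    omega
  have h2 := Set.ncard_le_ncard h1 ((Set.finite_Icc _ _).inter_of_right _)
  have h3 := hblock (n / s + 1)
  have h4 : ((n / s : ℕ) : ℝ) * s ≤ n := by exact_mod_cast Nat.div_mul_le_self n s
  have h5 : ((E ∩ Set.Icc 0 n).ncard : ℝ) ≤ (E ∩ Set.Icc 0 (K + (n / s + 1) * s)).ncard := by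
    exact_mod_cast h2
  push_cast at h3
  nlinarith [mul_le_mul_of_nonneg_left h4 hc0]

@[simp] lemma upperBanachDensity_empty : upperBanachDensity ∅ = 0 := by
  refine tendsto_nhds_unique (tendsto_windowDensity ∅) ?_
  have : windowDensity ∅ = fun _ => 0 := by
    funext s
    simp [windowDensity]
  rw [this]
  exact tendsto_const_nhds

/-! ### Supercyclicity of `B ⊕ Id` -/

section Families

variable {X : Type*} [NormedAddCommGroup X] [NormedSpace ℂ X]

lemma IsFamilyHypercyclic.mono {𝓕 𝓖 : Set (Set ℕ)} (h : 𝓕 ⊆ 𝓖) {Γ : Set ℂ} {T : X →L[ℂ] X}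
    (hT : IsFamilyHypercyclic 𝓕 Γ T) : IsFamilyHypercyclic 𝓖 Γ T :=
  hT.imp fun _ hx U hU hne => h (hx U hU hne)

lemma mem_returnSet_univ {T : X →L[ℂ] X} {x : X} {U : Set X} {n : ℕ} :
    n ∈ returnSet T Set.univ x U ↔ ∃ c : ℂ, c • (T ^ n) x ∈ U := by
  simp only [returnSet, Set.image_univ, Set.mem_ofPred_eq]
  constructor
  · rintro ⟨_, ⟨_, ⟨c, rfl⟩, rfl⟩, h⟩
    exact ⟨c, by simpa using h⟩
  · rintro ⟨c, h⟩
    exact ⟨_, ⟨_, ⟨c, rfl⟩, rfl⟩, by simpa using h⟩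

lemma isSupercyclic_iff {T : X →L[ℂ] X} :
    IsSupercyclic T ↔ IsFamilyHypercyclic {E | E.Nonempty} Set.univ T := by
  refine exists_congr fun x => ?_
  rw [dense_iff_inter_open]
  refine forall₃_congr fun U _ _ => ⟨?_, ?_⟩
  · rintro ⟨_, hU, c, n, rfl⟩
    exact ⟨n, mem_returnSet_univ.2 ⟨c, hU⟩⟩
  · rintro ⟨n, hn⟩
    obtain ⟨c, hc⟩ := mem_returnSet_univ.1 hn
    exact ⟨_, hc, c, n, rfl⟩

lemma sumId_pow_apply (B : X →L[ℂ] X) (n : ℕ) (x : SumC X) :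
    (sumId B ^ n) x = WithLp.toLp 1 ((B ^ n) x.fst, x.snd) := by
  induction n with
  | zero => rfl
  | succ n ih => rw [pow_succ', pow_succ', mul_apply_eq_comp, ih]; rfl

/-- The second coordinate does not move under the iterates, so projective approximation in the sum
is plain approximation in `X` after normalising that coordinate to 1. -/
theorem isFamilyHypercyclic_sumId_iff {𝓕 : Set (Set ℕ)}
    (hmono : ∀ E F : Set ℕ, E ⊆ F → E ∈ 𝓕 → F ∈ 𝓕) (B : X →L[ℂ] X) :
    IsFamilyHypercyclic 𝓕 Set.univ (sumId B) ↔
      ∃ x : X, ∀ (u : X) (δ : ℝ), 0 < δ → {n | ‖(B ^ n) x - u‖ < δ} ∈ 𝓕 := by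
  have hfst : Continuous fun y : SumC X => y.fst := (WithLp.prod_continuous_ofLp 1 X ℂ).fst
  have hsnd : Continuous fun y : SumC X => y.snd := (WithLp.prod_continuous_ofLp 1 X ℂ).snd
  have htoLp : Continuous fun y : X × ℂ => (WithLp.toLp 1 y : SumC X) :=
    WithLp.prod_continuous_toLp 1 X ℂ
  constructor
  · rintro ⟨x, hx⟩
    refine ⟨x.snd⁻¹ • x.fst, fun u δ hδ => ?_⟩
    -- The cone over the ball of radius `δ` around `u` at height 1: it is stable under non-zero
    -- scalars, so the unknown `c` cancels.
    set U : Set (SumC X) := {y | y.snd ≠ 0 ∧ ‖y.fst - y.snd • u‖ < δ * ‖y.snd‖} with hU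
    have hUo : IsOpen U := (isOpen_ne.preimage hsnd).inter
      (isOpen_lt (hfst.sub (hsnd.smul continuous_const)).norm (continuous_const.mul hsnd.norm))
    have hUne : U.Nonempty := ⟨WithLp.toLp 1 (u, 1), by simp [hU, hδ]⟩
    refine hmono _ _ (fun n hn => ?_) (hx U hUo hUne)
    obtain ⟨c, hc⟩ := mem_returnSet_univ.1 hn
    rw [sumId_pow_apply] at hc
    obtain ⟨h1, h2⟩ := hc
    change c * x.snd ≠ 0 at h1
    change ‖c • (B ^ n) x.fst - (c * x.snd) • u‖ < δ * ‖c * x.snd‖ at h2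
    have hc0 : c ≠ 0 := left_ne_zero_of_mul h1
    have hx0 : x.snd ≠ 0 := right_ne_zero_of_mul h1
    have heq : c • (B ^ n) x.fst - (c * x.snd) • u =
        (c * x.snd) • ((B ^ n) (x.snd⁻¹ • x.fst) - u) := by
      rw [map_smul, smul_sub, smul_smul, mul_assoc, mul_inv_cancel₀ hx0, mul_one]
    rw [heq, norm_smul, mul_comm] at h2
    exact lt_of_mul_lt_mul_right h2 (norm_nonneg _)
  · rintro ⟨x, hx⟩
    refine ⟨WithLp.toLp 1 (x, 1), fun U hU ⟨y, hy⟩ => ?_⟩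
    -- Move the second coordinate off zero inside `U`; the scalar `ζ` then serves for all return
    -- times at once.
    obtain ⟨ζ, hζU, hζ⟩ : ∃ ζ : ℂ, (WithLp.toLp 1 (y.fst, ζ) : SumC X) ∈ U ∧ ζ ≠ 0 := by
      have ho : IsOpen {ζ : ℂ | (WithLp.toLp 1 (y.fst, ζ) : SumC X) ∈ U} :=
        hU.preimage (htoLp.comp (by fun_prop))
      have hd : Dense ({0}ᶜ : Set ℂ) := dense_compl_singleton 0
      obtain ⟨ζ, h1, h2⟩ := hd.inter_open_nonempty _ ho ⟨y.snd, hy⟩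
      exact ⟨ζ, h1, h2⟩
    have hVo : IsOpen {u : X | (WithLp.toLp 1 (ζ • u, ζ) : SumC X) ∈ U} :=
      hU.preimage (htoLp.comp (by fun_prop))
    obtain ⟨δ, hδ, hball⟩ := Metric.isOpen_iff.1 hVo (ζ⁻¹ • y.fst) (by
      simpa [smul_smul, hζ] using hζU)
    refine hmono _ _ (fun n hn => ?_) (hx (ζ⁻¹ • y.fst) δ hδ)
    refine mem_returnSet_univ.2 ⟨ζ, ?_⟩
    have h := hball (show (B ^ n) x ∈ Metric.ball _ _ from by
      rw [Metric.mem_ball, dist_eq_norm]; exact hn)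
    rw [sumId_pow_apply]
    have heq : ζ • (WithLp.toLp 1 ((B ^ n) x, 1) : SumC X) = WithLp.toLp 1 (ζ • (B ^ n) x, ζ) := by
      rw [← WithLp.toLp_smul, Prod.smul_mk, smul_eq_mul, mul_one]
    exact heq ▸ h

lemma isFrequentlySupercyclic_sumId_iff (B : X →L[ℂ] X) :
    IsFrequentlySupercyclic (sumId B) ↔
      ∃ x : X, ∀ (u : X) (δ : ℝ), 0 < δ → 0 < lowerDensity {n | ‖(B ^ n) x - u‖ < δ} :=
  isFamilyHypercyclic_sumId_iff (fun _ _ h (hE : 0 < _) => hE.trans_le (lowerDensity_mono h)) B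

lemma isUFrequentlySupercyclic_sumId_iff (B : X →L[ℂ] X) :
    IsUFrequentlySupercyclic (sumId B) ↔
      ∃ x : X, ∀ (u : X) (δ : ℝ), 0 < δ → 0 < upperDensity {n | ‖(B ^ n) x - u‖ < δ} :=
  isFamilyHypercyclic_sumId_iff (fun _ _ h (hE : 0 < _) => hE.trans_le (upperDensity_mono h)) B

lemma isReiterativelySupercyclic_sumId_iff (B : X →L[ℂ] X) :
    IsReiterativelySupercyclic (sumId B) ↔
      ∃ x : X, ∀ (u : X) (δ : ℝ), 0 < δ → 0 < upperBanachDensity {n | ‖(B ^ n) x - u‖ < δ} :=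
  isFamilyHypercyclic_sumId_iff
    (fun _ _ h (hE : 0 < _) => hE.trans_le (upperBanachDensity_mono h)) B

lemma isSupercyclic_sumId_iff (B : X →L[ℂ] X) :
    IsSupercyclic (sumId B) ↔
      ∃ x : X, ∀ (u : X) (δ : ℝ), 0 < δ → {n | ‖(B ^ n) x - u‖ < δ}.Nonempty :=
  isSupercyclic_iff.trans
    (isFamilyHypercyclic_sumId_iff (fun _ _ h (hE : Set.Nonempty _) => hE.mono h) B)

lemma IsFrequentlySupercyclic.isUFrequentlySupercyclic {T : X →L[ℂ] X}
    (h : IsFrequentlySupercyclic T) : IsUFrequentlySupercyclic T :=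
  IsFamilyHypercyclic.mono
    (fun E (hE : 0 < lowerDensity E) => hE.trans_le (lowerDensity_le_upperDensity E)) h

lemma IsUFrequentlySupercyclic.isReiterativelySupercyclic {T : X →L[ℂ] X}
    (h : IsUFrequentlySupercyclic T) : IsReiterativelySupercyclic T :=
  IsFamilyHypercyclic.mono
    (fun E (hE : 0 < upperDensity E) => hE.trans_le (upperDensity_le_upperBanachDensity E)) h

lemma IsReiterativelySupercyclic.isSupercyclic {T : X →L[ℂ] X}
    (h : IsReiterativelySupercyclic T) : IsSupercyclic T := by
  refine isSupercyclic_iff.2 (IsFamilyHypercyclic.mono (fun E (hE : 0 < upperBanachDensity E) => ?_) h)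
  rw [Set.mem_ofPred_eq, Set.nonempty_iff_ne_empty]
  rintro rfl
  simp at hE

end Families

/-! ### Exponent sequences with prescribed lower bounds -/

open Classical in
/-- The smallest sequence `f` increasing by at most `1` in each step such that `r ≤ f i` whenever
`R i r` holds. -/
noncomputable def envelope (R : ℕ → ℕ → Prop) (j : ℕ) : ℕ :=
  Nat.findGreatest (fun m => ∃ t, R (j + t) (m + t)) j

section Envelope

variable {R : ℕ → ℕ → Prop}

@[simp] lemma envelope_zero (R : ℕ → ℕ → Prop) : envelope R 0 = 0 := rfl

open Classical in
lemma le_envelope (hR : ∀ i r, R i r → r ≤ i) {i r : ℕ} (h : R i r) : r ≤ envelope R i :=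
  Nat.le_findGreatest (hR i r h) ⟨0, h⟩

open Classical in
-- Positive values arise only on the ramp leading up to a prescribed bound. This is what localises
-- the places where the exponent is large.
lemma exists_of_envelope_pos {j : ℕ} (h : 0 < envelope R j) :
    ∃ t, R (j + t) (envelope R j + t) :=
  Nat.findGreatest_of_ne_zero (P := fun m => ∃ t, R (j + t) (m + t)) rfl h.ne'

open Classical in
lemma envelope_succ_le (hR : ∀ i r, R i r → r ≤ i) (j : ℕ) :
    envelope R (j + 1) ≤ envelope R j + 1 := by
  rcases Nat.eq_zero_or_pos (envelope R (j + 1)) with h | h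
  · omega
  obtain ⟨t, ht⟩ := exists_of_envelope_pos h
  have h1 := hR _ _ ht
  have : envelope R (j + 1) - 1 ≤ envelope R j := by
    refine Nat.le_findGreatest (by omega) ⟨t + 1, ?_⟩
    convert ht using 1 <;> omega
  omega

lemma envelope_add_le (hR : ∀ i r, R i r → r ≤ i) (j k : ℕ) :
    envelope R (j + k) ≤ envelope R j + k := by
  induction k with
  | zero => simp
  | succ k ih => have := envelope_succ_le hR (j + k); rw [← add_assoc]; omega

end Envelope

/-! ### Weighted backward shifts -/

/-- The weights `w` such that `w 0 * ⋯ * w (n - 1) = 2 ^ (f n - f 0)`. -/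
noncomputable def stepWeight (f : ℕ → ℕ) (n : ℕ) : ℝ := 2 ^ f (n + 1) / 2 ^ f n

lemma stepWeight_pos (f : ℕ → ℕ) (n : ℕ) : 0 < stepWeight f n := by
  unfold stepWeight; positivity

lemma stepWeight_le_two {f : ℕ → ℕ} (hf : ∀ n, f (n + 1) ≤ f n + 1) (n : ℕ) :
    stepWeight f n ≤ 2 := by
  rw [stepWeight, div_le_iff₀ (by positivity), ← pow_succ']
  exact pow_le_pow_right₀ one_le_two (hf n)

lemma isWeight_stepWeight {f : ℕ → ℕ} (hf : ∀ n, f (n + 1) ≤ f n + 1) : IsWeight (stepWeight f) :=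
  ⟨stepWeight_pos f, 2, by rintro _ ⟨n, rfl⟩; exact stepWeight_le_two hf n⟩

lemma norm_stepWeight_mul_le {f : ℕ → ℕ} (hf : ∀ n, f (n + 1) ≤ f n + 1) (n : ℕ) (z : ℂ) :
    ‖(stepWeight f n : ℂ) * z‖ ≤ 2 * ‖z‖ := by
  rw [norm_mul, Complex.norm_real, Real.norm_of_nonneg (stepWeight_pos f n).le]
  gcongr
  exact stepWeight_le_two hf n

/-- The weights telescope. The abstract coordinate map `coord` lets the formula serve both `c₀` and
`ℓ_p`. -/
lemma shift_pow_apply {X : Type*} [NormedAddCommGroup X] [NormedSpace ℂ X] {B : X →L[ℂ] X}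
    {coord : X → ℕ → ℂ} {f : ℕ → ℕ}
    (hB : ∀ x n, coord (B x) n = (stepWeight f n : ℂ) * coord x (n + 1)) (n : ℕ) (x : X) (k : ℕ) :
    coord ((B ^ n) x) k = 2 ^ f (n + k) / 2 ^ f k * coord x (n + k) := by
  induction n generalizing k with
  | zero => simp
  | succ n ih =>
    rw [pow_succ', mul_apply_eq_comp, hB, ih, stepWeight,
      show n + (k + 1) = n + 1 + k by ring]
    push_cast
    field_simp

lemma tendsto_cZero (x : cZero) : Tendsto x atTop (𝓝 0) := by
  have := x.zero_at_infty'
  rwa [cocompact_eq_cofinite, Nat.cofinite_eq_atTop] at this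

/-- A null sequence as an element of `c₀(ℕ)`. -/
def cZero.mk (x : ℕ → ℂ) (hx : Tendsto x atTop (𝓝 0)) : cZero where
  toFun := x
  continuous_toFun := continuous_of_discreteTopology
  zero_at_infty' := by rwa [cocompact_eq_cofinite, Nat.cofinite_eq_atTop]

@[simp] lemma cZero.mk_apply (x : ℕ → ℂ) (hx : Tendsto x atTop (𝓝 0)) (n : ℕ) :
    cZero.mk x hx n = x n := rfl

lemma cZero.norm_le {x : cZero} {C : ℝ} (hC : 0 ≤ C) (h : ∀ n, ‖x n‖ ≤ C) : ‖x‖ ≤ C := by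
  rw [← ZeroAtInftyContinuousMap.norm_toBCF_eq_norm]
  exact (BoundedContinuousFunction.norm_le hC).2 h

lemma cZero.norm_apply_le (x : cZero) (n : ℕ) : ‖x n‖ ≤ ‖x‖ := by
  rw [← ZeroAtInftyContinuousMap.norm_toBCF_eq_norm]
  exact x.toBCF.norm_coe_le_norm n

lemma exists_isBackwardShiftCZero {f : ℕ → ℕ} (hf : ∀ n, f (n + 1) ≤ f n + 1) :
    ∃ B : cZero →L[ℂ] cZero, IsBackwardShiftCZero (stepWeight f) B := by
  have hlim (x : cZero) :
      Tendsto (fun n => (stepWeight f n : ℂ) * x (n + 1)) atTop (𝓝 0) := by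
    refine squeeze_zero_norm (fun n => norm_stepWeight_mul_le hf n _) ?_
    simpa using ((tendsto_add_atTop_iff_nat 1).2 (tendsto_cZero x)).norm.const_mul 2
  let L : cZero →ₗ[ℂ] cZero :=
    { toFun := fun x => cZero.mk _ (hlim x)
      map_add' := fun x y => by ext n; simp [mul_add]
      map_smul' := fun c x => by ext n; simp [mul_left_comm] }
  refine ⟨L.mkContinuous 2 fun x => cZero.norm_le (by positivity) fun n => ?_, fun x n => rfl⟩
  exact (norm_stepWeight_mul_le hf n _).trans (by gcongr; exact cZero.norm_apply_le x _)

lemma exists_isBackwardShiftEllP {p : ENNReal} [Fact (1 ≤ p)] (hp : p ≠ ⊤) {f : ℕ → ℕ}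
    (hf : ∀ n, f (n + 1) ≤ f n + 1) :
    ∃ B : ellP p →L[ℂ] ellP p, IsBackwardShiftEllP (stepWeight f) B := by
  have hp0 : 0 < p.toReal := ENNReal.toReal_pos (zero_lt_one.trans_le Fact.out).ne' hp
  have hle (x : ellP p) (n : ℕ) : ‖(stepWeight f n : ℂ) * x (n + 1)‖ ^ p.toReal ≤
      2 ^ p.toReal * ‖x (n + 1)‖ ^ p.toReal := by
    rw [← Real.mul_rpow zero_le_two (norm_nonneg _)]
    exact Real.rpow_le_rpow (norm_nonneg _) (norm_stepWeight_mul_le hf n _) hp0.le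
  have hsum (x : ellP p) : Summable fun n => ‖x n‖ ^ p.toReal := (lp.memℓp x).summable hp0
  have hmem (x : ellP p) : Memℓp (fun n => (stepWeight f n : ℂ) * x (n + 1)) p :=
    memℓp_gen (Summable.of_nonneg_of_le (fun n => by positivity) (hle x)
      (((summable_nat_add_iff 1).2 (hsum x)).mul_left _))
  let L : ellP p →ₗ[ℂ] ellP p :=
    { toFun := fun x => ⟨_, hmem x⟩
      map_add' := fun x y => by ext n; exact mul_add _ _ _
      map_smul' := fun c x => by ext n; simp [mul_left_comm] }
  refine ⟨L.mkContinuous 2 fun x => ?_, fun x n => rfl⟩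
  refine lp.norm_le_of_forall_sum_le hp0 (by positivity) fun s => ?_
  rw [Real.mul_rpow zero_le_two (norm_nonneg _), lp.norm_rpow_eq_tsum hp0]
  calc ∑ n ∈ s, ‖L x n‖ ^ p.toReal ≤ ∑ n ∈ s, 2 ^ p.toReal * ‖x (n + 1)‖ ^ p.toReal :=
        Finset.sum_le_sum fun n _ => hle x n
    _ = 2 ^ p.toReal * ∑ n ∈ s, ‖x (n + 1)‖ ^ p.toReal := by rw [Finset.mul_sum]
    _ ≤ 2 ^ p.toReal * ∑' n, ‖x n‖ ^ p.toReal := by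
        gcongr
        calc _ ≤ ∑' n, ‖x (n + 1)‖ ^ p.toReal :=
              ((summable_nat_add_iff 1).2 (hsum x)).sum_le_tsum s fun n _ => by positivity
          _ ≤ _ := by
              rw [(hsum x).tsum_eq_zero_add]
              exact le_add_of_nonneg_left (by positivity)

/-! ### Exponents which are large on zones and on sparse periodic sets -/

/-- The zones `[a l, b (l + 1)]` are consecutive, and each is long compared to the position of the
preceding one. -/
structure IsZoneSequence (a b : ℕ → ℕ) : Prop where
  pos : ∀ l, 0 < a l
  two_mul_le : ∀ l, 2 * l ≤ a l
  add_two_le : ∀ l, a l + 2 ≤ a (l + 1)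
  right_le_left : ∀ l, b l ≤ a l
  add_le : ∀ l, a l + b l ≤ b (l + 1)

/-- The period along which blocks of the `p`-th target are repeated. -/
def period (p : ℕ) : ℕ := 2 ^ (p + 3) * (p + 1)

/-- Lower bounds for the exponents: `2 * l` on the `l`-th zone, and `2 * p` to the right of the
positive multiples of `period p`. -/
def ZoneBound (a b : ℕ → ℕ) (i r : ℕ) : Prop :=
  (∃ l, a l ≤ i ∧ i ≤ b (l + 1) ∧ r ≤ 2 * l) ∨
    ∃ p, period p ≤ i ∧ i % period p ≤ p ∧ r ≤ 2 * p

/-- The left part of the zones is removed to leave room for differences of their elements. -/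
def InZone (a b : ℕ → ℕ) (l m : ℕ) : Prop := a l + b l ≤ m ∧ m ≤ b (l + 1)

open Classical in
/-- The sequence which repeats, on the `l`-th zone, the block `z p` with period `period p`, where
`p` is the first component of `Nat.unpair l`. -/
noncomputable def blockSeq (a b : ℕ → ℕ) (z : ℕ → ℕ → ℂ) (m : ℕ) : ℂ :=
  if h : ∃ l, InZone a b l m then z h.choose.unpair.1 (m % period h.choose.unpair.1) else 0

lemma eight_mul_succ_le_period (p : ℕ) : 8 * (p + 1) ≤ period p := by
  unfold period
  gcongr
  calc 8 = 2 ^ 3 := rfl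
    _ ≤ 2 ^ (p + 3) := Nat.pow_le_pow_right two_pos (by omega)

lemma period_pos (p : ℕ) : 0 < period p := by have := eight_mul_succ_le_period p; omega

section Zones

variable {a b : ℕ → ℕ}

lemma IsZoneSequence.monotone_right (h : IsZoneSequence a b) : Monotone b :=
  monotone_nat_of_le_succ fun l => by have := h.add_le l; omega

lemma IsZoneSequence.left_add_le (h : IsZoneSequence a b) (l k : ℕ) :
    a l + 2 * k ≤ a (l + k) := by
  induction k with
  | zero => simp
  | succ k ih => have := h.add_two_le (l + k); rw [← add_assoc]; omega

lemma IsZoneSequence.monotone_left (h : IsZoneSequence a b) : Monotone a :=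
  monotone_nat_of_le_succ fun l => by have := h.add_two_le l; omega

lemma IsZoneSequence.le_of_zoneBound (h : IsZoneSequence a b) (i r : ℕ) (hr : ZoneBound a b i r) :
    r ≤ i := by
  rcases hr with ⟨l, h1, -, h2⟩ | ⟨p, h1, -, h2⟩
  · have := h.two_mul_le l; omega
  · have := eight_mul_succ_le_period p; omega

lemma IsZoneSequence.inZone_unique (h : IsZoneSequence a b) {k l m : ℕ} (hk : InZone a b k m)
    (hl : InZone a b l m) : k = l := by
  have aux : ∀ k l, InZone a b k m → InZone a b l m → ¬k < l := fun k l hk hl hkl => by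
    have h1 := h.monotone_right (show k + 1 ≤ l from hkl)
    have := h.pos l
    have := hk.2
    have := hl.1
    omega
  exact le_antisymm (not_lt.1 (aux l k hl hk)) (not_lt.1 (aux k l hk hl))

variable {z : ℕ → ℕ → ℂ}

lemma blockSeq_of_inZone (h : IsZoneSequence a b) {l m : ℕ} (hm : InZone a b l m) :
    blockSeq a b z m = z l.unpair.1 (m % period l.unpair.1) := by
  have hex : ∃ l, InZone a b l m := ⟨l, hm⟩
  rw [blockSeq, dif_pos hex, h.inZone_unique hex.choose_spec hm]

lemma blockSeq_of_not_inZone {m : ℕ} (hm : ¬∃ l, InZone a b l m) : blockSeq a b z m = 0 :=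
  dif_neg hm

/-- On zone `l` the block entries are at most `2 ^ l` while the exponent is at least `2 * l`,
leaving `2 ^ (-l)`. -/
lemma tendsto_blockSeq (h : IsZoneSequence a b) (hz : ∀ p j, ‖z p j‖ ≤ 2 ^ p) :
    Tendsto (fun m => blockSeq a b z m / 2 ^ envelope (ZoneBound a b) m) atTop (𝓝 0) := by
  rw [Metric.tendsto_atTop]
  intro ε hε
  obtain ⟨L, hL⟩ := exists_pow_lt_of_lt_one hε (show (1 / 2 : ℝ) < 1 by norm_num)
  refine ⟨b L + 1, fun m hm => ?_⟩
  rw [dist_zero_right]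
  by_cases hex : ∃ l, InZone a b l m
  · obtain ⟨l, hl⟩ := hex
    have hLl : L ≤ l := by
      by_contra hlt
      have := h.monotone_right (show l + 1 ≤ L by omega)
      have := hl.2
      omega
    have hf : 2 * l ≤ envelope (ZoneBound a b) m :=
      le_envelope h.le_of_zoneBound (Or.inl ⟨l, by have := hl.1; omega, hl.2, le_rfl⟩)
    rw [blockSeq_of_inZone h hl, norm_div, norm_pow, Complex.norm_ofNat]
    refine lt_of_le_of_lt ?_ hL
    rw [div_le_iff₀ (by positivity)]
    calc ‖z l.unpair.1 _‖ ≤ (2 : ℝ) ^ l.unpair.1 := hz _ _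
      _ ≤ 2 ^ l := pow_le_pow_right₀ one_le_two (Nat.unpair_left_le l)
      _ = (1 / 2) ^ l * 2 ^ (2 * l) := by
          rw [pow_mul, ← mul_pow]; norm_num
      _ ≤ (1 / 2) ^ L * 2 ^ envelope (ZoneBound a b) m := by
          gcongr ?_ * ?_
          · exact pow_le_pow_of_le_one (by norm_num) (by norm_num) hLl
          · exact pow_le_pow_right₀ one_le_two hf
  · simpa [blockSeq_of_not_inZone hex] using hε

/-- The first period after `n` reproduces the block exactly. Beyond it, a non-zero entry at `n + j`
is either a repetition in the same zone, where `j` is near a multiple of the period, or lies in a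
later zone `k`. In the latter case `n ≤ b k`, and the removal of the left part of zone `k` puts `j`
itself between `a k` and `b (k + 1)`. Either way the exponent at `j` absorbs the entry. -/
lemma norm_blockSeq_sub_le (h : IsZoneSequence a b) (hz : ∀ p j, ‖z p j‖ ≤ 2 ^ p)
    (hz0 : ∀ p j, p ≤ j → z p j = 0) {l n : ℕ} (hdvd : period l.unpair.1 ∣ n)
    (hn : a l + b l ≤ n) (hn' : n + period l.unpair.1 ≤ b (l + 1)) (j : ℕ) :
    ‖blockSeq a b z (n + j) - z l.unpair.1 j‖ ≤
      2 ^ envelope (ZoneBound a b) j / 2 ^ l.unpair.1 := by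
  set p := l.unpair.1 with hp
  have hpl : p ≤ l := Nat.unpair_left_le l
  have hnonneg : (0 : ℝ) ≤ 2 ^ envelope (ZoneBound a b) j / 2 ^ p := by positivity
  have hg := eight_mul_succ_le_period p
  have hmod : (n + j) % period p = j % period p := by
    obtain ⟨q, rfl⟩ := hdvd
    exact Nat.mul_add_mod ..
  rcases lt_or_ge j (period p) with hj | hj
  · rw [blockSeq_of_inZone h (l := l) ⟨by omega, by omega⟩, ← hp, hmod, Nat.mod_eq_of_lt hj]
    simpa using hnonneg
  rw [hz0 p j (by omega), sub_zero]
  by_cases hex : ∃ k, InZone a b k (n + j)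
  · obtain ⟨k, hk⟩ := hex
    rw [blockSeq_of_inZone h hk]
    rcases lt_trichotomy k l with hkl | rfl | hkl
    · have := h.monotone_right (show k + 1 ≤ l from hkl)
      have := hk.2
      have := h.pos l
      omega
    · rw [← hp, hmod]
      rcases le_or_gt p (j % period p) with hjp | hjp
      · rw [hz0 _ _ hjp, norm_zero]
        exact hnonneg
      · have hf : 2 * p ≤ envelope (ZoneBound a b) j :=
          le_envelope h.le_of_zoneBound (Or.inr ⟨p, hj, hjp.le, le_rfl⟩)
        refine (hz _ _).trans ?_
        rw [le_div_iff₀ (by positivity), ← pow_add]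
        exact pow_le_pow_right₀ one_le_two (by omega)
    · have := h.monotone_right (show l + 1 ≤ k from hkl)
      have h1 := hk.1
      have h2 := hk.2
      have hf : 2 * k ≤ envelope (ZoneBound a b) j :=
        le_envelope h.le_of_zoneBound (Or.inl ⟨k, by omega, by omega, le_rfl⟩)
      refine (hz _ _).trans ?_
      have := Nat.unpair_left_le k
      rw [le_div_iff₀ (by positivity), ← pow_add]
      exact pow_le_pow_right₀ one_le_two (by omega)
  · rw [blockSeq_of_not_inZone hex, norm_zero]
    exact hnonneg

end Zones

/-! ### Dense finite blocks and a vector visiting the zones -/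

lemma exists_dense_blocks : ∃ z : ℕ → ℕ → ℂ, (∀ p j, ‖z p j‖ ≤ 2 ^ p) ∧
    (∀ p j, p ≤ j → z p j = 0) ∧
    ∀ (y : ℕ → ℂ) (J P : ℕ) (δ : ℝ), 0 < δ →
      ∃ p, P ≤ p ∧ (∀ j < J, ‖z p j - y j‖ < δ) ∧ ∀ j, J ≤ j → z p j = 0 := by
  classical
  let d : ℕ → ℂ := TopologicalSpace.denseSeq ℂ
  have hd : DenseRange d := TopologicalSpace.denseRange_denseSeq ℂ
  obtain ⟨code, hcode⟩ := exists_surjective_nat (List ℕ)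
  let t : ℕ → ℕ → ℂ := fun c j => ((code c)[j]?.map d).getD 0
  -- Each coded list recurs for infinitely many `p`; the truncation enforces the support and size
  -- bounds and is inactive once `p` is large.
  let z : ℕ → ℕ → ℂ := fun p j =>
    if j < p ∧ ‖t p.unpair.1 j‖ ≤ 2 ^ p then t p.unpair.1 j else 0
  refine ⟨z, fun p j => ?_, fun p j hpj => if_neg fun h => by omega, fun y J P δ hδ => ?_⟩
  · by_cases h : j < p ∧ ‖t p.unpair.1 j‖ ≤ 2 ^ p
    · simpa only [z, if_pos h] using h.2
    · simp only [z, if_neg h, norm_zero]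
      positivity
  have hex (j : ℕ) : ∃ i, ‖d i - y j‖ < δ := by
    obtain ⟨i, hi⟩ := hd.exists_dist_lt (y j) hδ
    exact ⟨i, by rwa [← dist_eq_norm, dist_comm]⟩
  choose i hi using hex
  obtain ⟨c, hc⟩ := hcode ((List.range J).map i)
  have htlt (j : ℕ) (hj : j < J) : t c j = d (i j) := by simp [t, hc, hj]
  have htge (j : ℕ) (hj : J ≤ j) : t c j = 0 := by simp [t, hc, hj]
  obtain ⟨M, hM⟩ := pow_unbounded_of_one_lt (∑ j ∈ Finset.range J, ‖t c j‖) one_lt_two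
  set m := max M (max J P) with hm
  have hmp : m ≤ Nat.pair c m := Nat.right_le_pair c m
  refine ⟨Nat.pair c m, by omega, fun j hj => ?_, fun j hj => ?_⟩
  · have hcond : j < Nat.pair c m ∧ ‖t (Nat.pair c m).unpair.1 j‖ ≤ 2 ^ Nat.pair c m := by
      refine ⟨by omega, ?_⟩
      rw [Nat.unpair_pair]
      calc ‖t c j‖ ≤ ∑ j ∈ Finset.range J, ‖t c j‖ :=
            Finset.single_le_sum (f := fun j => ‖t c j‖) (fun _ _ => norm_nonneg _)
              (Finset.mem_range.2 hj)
        _ ≤ 2 ^ M := hM.le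
        _ ≤ 2 ^ Nat.pair c m := pow_le_pow_right₀ one_le_two (by omega)
    simp only [z, if_pos hcond]
    rw [Nat.unpair_pair, htlt j hj]
    exact hi j
  · simp only [z, Nat.unpair_pair, htge j hj, ite_self]

/-- In the weighted shift whose weights are associated with a zone sequence, some vector visits
each ball along a full periodic subset of infinitely many zones. -/
theorem exists_vector_visiting_zones {a b : ℕ → ℕ} (h : IsZoneSequence a b)
    {B : cZero →L[ℂ] cZero}
    (hB : IsBackwardShiftCZero (stepWeight (envelope (ZoneBound a b))) B) :
    ∃ x : cZero, ∀ (u : cZero) (δ : ℝ), 0 < δ → ∃ p, ∀ l n : ℕ, l.unpair.1 = p → period p ∣ n →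
      a l + b l ≤ n → n + period p ≤ b (l + 1) → ‖(B ^ n) x - u‖ < δ := by
  obtain ⟨z, hz, hz0, hdense⟩ := exists_dense_blocks
  set f := envelope (ZoneBound a b) with hf
  refine ⟨cZero.mk _ (tendsto_blockSeq (z := z) h hz), fun u δ hδ => ?_⟩
  have hδ3 : 0 < δ / 3 := by positivity
  obtain ⟨J, hJ⟩ := Metric.tendsto_atTop.1 (tendsto_cZero u) (δ / 3) hδ3
  obtain ⟨P, hP⟩ := exists_pow_lt_of_lt_one hδ3 (show (1 / 2 : ℝ) < 1 by norm_num)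
  -- Coordinate `j` of `B^n x` is `blockSeq a b z (n + j) / 2 ^ f j`, so the block has to
  -- approximate `2 ^ f j * u j`.
  obtain ⟨p, hPp, hlt, hge⟩ := hdense (fun j => 2 ^ f j * u j) J P (δ / 3) hδ3
  refine ⟨p, ?_⟩
  rintro l n rfl hdvd hn hn'
  refine lt_of_le_of_lt (cZero.norm_le (C := δ / 3 + δ / 3) (by positivity) fun j => ?_)
    (by linarith)
  have hpos : (0 : ℝ) < 2 ^ f j := by positivity
  have hne : (2 : ℂ) ^ f j ≠ 0 := pow_ne_zero _ two_ne_zero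
  have hnorm : ‖(2 : ℂ) ^ f j‖ = 2 ^ f j := by simp
  have h1 := norm_blockSeq_sub_le h hz hz0 hdvd hn hn' j
  have h2 : ‖z l.unpair.1 j - 2 ^ f j * u j‖ ≤ δ / 3 * 2 ^ f j := by
    rcases lt_or_ge j J with hj | hj
    · exact (hlt j hj).le.trans (le_mul_of_one_le_right hδ3.le (one_le_pow₀ one_le_two))
    · rw [hge j hj, zero_sub, norm_neg, norm_mul, hnorm, mul_comm]
      have := hJ j hj
      rw [dist_zero_right] at this
      gcongr
  have hsplit : ((B ^ n) (cZero.mk _ (tendsto_blockSeq (z := z) h hz)) - u) j =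
      ((blockSeq a b z (n + j) - z l.unpair.1 j) + (z l.unpair.1 j - 2 ^ f j * u j)) /
        2 ^ f j := by
    rw [ZeroAtInftyContinuousMap.sub_apply,
      shift_pow_apply (coord := fun (x : cZero) n => x n) hB, cZero.mk_apply]
    have hne' : (2 : ℂ) ^ f (n + j) ≠ 0 := pow_ne_zero _ two_ne_zero
    field_simp
    ring
  rw [hsplit, norm_div, hnorm, div_le_iff₀ hpos, add_mul]
  refine (norm_add_le _ _).trans (add_le_add (h1.trans ?_) h2)
  rw [div_eq_mul_inv, mul_comm, ← inv_pow]
  gcongr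
  calc ((2 : ℝ)⁻¹) ^ l.unpair.1 ≤ (1 / 2) ^ P := by
        rw [← one_div]
        exact pow_le_pow_of_le_one (by norm_num) (by norm_num) hPp
    _ ≤ δ / 3 := hP.le

lemma div_le_ncard_of_dvd {E : Set ℕ} {g k s : ℕ} (hg : 0 < g) (hk : g ∣ k)
    (h : ∀ n, g ∣ n → k ≤ n → n ≤ k + s → n ∈ E) :
    s / g ≤ (E ∩ Set.Icc (k + 1) (k + s)).ncard := by
  have hsub : ((Finset.range (s / g)).image fun i => k + g * (i + 1) : Set ℕ) ⊆
      E ∩ Set.Icc (k + 1) (k + s) := by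
    rintro _ hx
    simp only [Finset.coe_range, Set.mem_image, Set.mem_Iio, Finset.coe_image] at hx
    obtain ⟨i, hi, rfl⟩ := hx
    have h1 : g * (i + 1) ≤ s := (Nat.mul_le_mul_left g hi).trans (Nat.mul_div_le s g)
    have h2 : g ≤ g * (i + 1) := Nat.le_mul_of_pos_right _ (by omega)
    exact ⟨h _ (dvd_add hk (dvd_mul_right _ _)) (by omega) (by omega), by omega, by omega⟩
  have := Set.ncard_le_ncard hsub ((Set.finite_Icc _ _).inter_of_right _)
  rwa [Set.ncard_coe_finset, Finset.card_image_of_injective, Finset.card_range]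
    at this
  intro i j hij
  simpa [hg.ne'] using hij

/-! ### Bounds for the return sets -/

/-- At a return, `2 ^ f n * ‖x n‖ > 1 / 2`, while `x n` tends to zero. -/
lemma eventually_le_of_norm_shift_pow_sub_lt {f : ℕ → ℕ} (hf0 : f 0 = 0) {B : cZero →L[ℂ] cZero}
    (hB : IsBackwardShiftCZero (stepWeight f) B) (x : cZero) {u : cZero} (hu : u 0 = 1) (c : ℕ) :
    ∃ N, ∀ n, N ≤ n → ‖(B ^ n) x - u‖ < 1 / 2 → c ≤ f n := by
  obtain ⟨N, hN⟩ := Metric.tendsto_atTop.1 (tendsto_cZero x) ((1 / 2) * (1 / 2) ^ c)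
    (by positivity)
  refine ⟨N, fun n hn hlt => ?_⟩
  have h1 := (cZero.norm_apply_le _ 0).trans_lt hlt
  rw [ZeroAtInftyContinuousMap.sub_apply,
    shift_pow_apply (coord := fun (x : cZero) n => x n) hB, hu] at h1
  have h2 := hN n hn
  rw [dist_zero_right] at h2
  simp only [add_zero, hf0, pow_zero, div_one] at h1
  have h3 : 1 / 2 < ‖(2 : ℂ) ^ f n * x n‖ := by
    have h4 := norm_sub_norm_le (1 : ℂ) (2 ^ f n * x n)
    rw [norm_sub_rev, norm_one] at h4
    linarith
  rw [norm_mul, norm_pow, Complex.norm_ofNat] at h3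
  by_contra hlt'
  have h5 : (2 : ℝ) ^ f n ≤ 2 ^ c := pow_le_pow_right₀ one_le_two (by omega)
  have h6 : (2 : ℝ) ^ f n * ‖x n‖ ≤ 2 ^ c * (1 / 2 * (1 / 2) ^ c) := by gcongr
  have h7 : (2 : ℝ) ^ c * (1 / 2 * (1 / 2) ^ c) = 1 / 2 := by
    rw [mul_left_comm, ← mul_pow]; norm_num
  linarith

/-- The integers near the zones. -/
def zoneNhd (a b : ℕ → ℕ) : Set ℕ := {j | ∃ l, a l ≤ j + 2 * l ∧ j ≤ b (l + 1)}

/-- Off the zones, an exponent of at least `2 * c` comes from a multiple of `period p` with `p ≥ c`,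
and lies in an interval of at most `3 * p + 1` points around it. The factor `p + 1` in the period
pays for this width, and `2 ^ (p + 3)` makes the resulting densities a geometric series in `p`. -/
lemma ncard_envelope_ge_le (a b : ℕ → ℕ) {c : ℕ} (hc : 0 < c) (n : ℕ) :
    (({j | 2 * c ≤ envelope (ZoneBound a b) j} ∩ Set.Icc 0 n).ncard : ℝ) ≤
      (zoneNhd a b ∩ Set.Icc 0 n).ncard + 2 * (1 / 2) ^ c * n := by
  let S : Finset ℕ := (Finset.Icc c n).biUnion fun p =>
    (Finset.Icc 1 (2 * n / period p)).biUnion fun k =>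
      Finset.Icc (k * period p - 2 * p) (k * period p + p)
  have hsub : {j | 2 * c ≤ envelope (ZoneBound a b) j} ∩ Set.Icc 0 n ⊆
      (zoneNhd a b ∩ Set.Icc 0 n) ∪ S := by
    rintro j ⟨hj : 2 * c ≤ _, -, hjn⟩
    obtain ⟨t, ht⟩ := exists_of_envelope_pos (show 0 < envelope (ZoneBound a b) j by omega)
    rcases ht with ⟨l, h1, h2, h3⟩ | ⟨p, h1, h2, h3⟩
    · exact Or.inl ⟨⟨l, by omega, by omega⟩, Nat.zero_le _, hjn⟩
    · right
      have hg := eight_mul_succ_le_period p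
      have hdiv := Nat.div_add_mod (j + t) (period p)
      have hk : 1 ≤ (j + t) / period p := (Nat.one_le_div_iff (by omega)).2 h1
      set k := (j + t) / period p
      have hkg : period p ≤ period p * k := Nat.le_mul_of_pos_right _ hk
      simp only [S, Finset.coe_biUnion, Set.mem_iUnion, Finset.mem_coe, Finset.mem_Icc]
      refine ⟨p, ⟨by omega, by omega⟩, k, ⟨hk, ?_⟩, ?_, ?_⟩
      · rw [Nat.le_div_iff_mul_le (by omega), mul_comm]
        omega
      · rw [mul_comm]; omega
      · rw [mul_comm]; omega
  have hcard : (S.card : ℝ) ≤ 2 * (1 / 2) ^ c * n := by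
    have h1 : S.card ≤ ∑ p ∈ Finset.Icc c n, (2 * n / period p) * (3 * p + 1) := by
      refine Finset.card_biUnion_le.trans (Finset.sum_le_sum fun p _ => ?_)
      refine (Finset.card_biUnion_le_card_mul _ _ (3 * p + 1) fun k _ => ?_).trans (by simp)
      rw [Nat.card_Icc]
      omega
    calc (S.card : ℝ) ≤ ∑ p ∈ Finset.Icc c n, ((2 * n / period p : ℕ) : ℝ) * (3 * p + 1) := by
          exact_mod_cast h1
      _ ≤ ∑ p ∈ Finset.Icc c n, (1 / 2) ^ p * (n : ℝ) := by
          refine Finset.sum_le_sum fun p _ => ?_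
          have h2 : ((2 * n / period p : ℕ) : ℝ) ≤ 2 * n / period p := by
            exact_mod_cast Nat.cast_div_le (α := ℝ) (m := 2 * n) (n := period p)
          have h3 : (period p : ℝ) = 2 ^ p * 8 * (p + 1) := by
            simp only [period, pow_add]; push_cast; norm_num
          calc _ ≤ (2 * n / period p : ℝ) * (3 * p + 1) := by gcongr
            _ ≤ (2 * n / period p : ℝ) * (4 * (p + 1)) := by gcongr; linarith
            _ = (1 / 2) ^ p * (n : ℝ) := by rw [h3, one_div, inv_pow]; field_simp; ring
      _ = (∑ p ∈ Finset.Ico c (n + 1), (1 / 2 : ℝ) ^ p) * n := by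
          rw [Finset.sum_mul]; rfl
      _ ≤ ((1 / 2) ^ c / (1 - 1 / 2)) * n := by
          gcongr
          exact geom_sum_Ico_le_of_lt_one (by norm_num) (by norm_num)
      _ = _ := by ring
  have h := (Set.ncard_le_ncard hsub (((Set.finite_Icc _ _).inter_of_right _).union
    S.finite_toSet)).trans (Set.ncard_union_le _ _)
  rw [Set.ncard_coe_finset] at h
  have h' : (({j | 2 * c ≤ envelope (ZoneBound a b) j} ∩ Set.Icc 0 n).ncard : ℝ) ≤
      (zoneNhd a b ∩ Set.Icc 0 n).ncard + S.card := by exact_mod_cast h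
  linarith

/-- Up to a set of small density, a return set of the shift lies near the zones. -/
theorem eventually_ncard_returns_le {a b : ℕ → ℕ} {B : cZero →L[ℂ] cZero}
    (hB : IsBackwardShiftCZero (stepWeight (envelope (ZoneBound a b))) B) (x : cZero) {u : cZero}
    (hu : u 0 = 1) {ε : ℝ} (hε : 0 < ε) :
    ∀ᶠ n : ℕ in atTop, (({n | ‖(B ^ n) x - u‖ < 1 / 2} ∩ Set.Icc 0 n).ncard : ℝ) ≤
      (zoneNhd a b ∩ Set.Icc 0 n).ncard + ε * n := by
  obtain ⟨c, hc⟩ := exists_pow_lt_of_lt_one (show 0 < ε / 4 by positivity)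
    (show (1 / 2 : ℝ) < 1 by norm_num)
  have hc1 : (1 / 2 : ℝ) ^ (c + 1) < ε / 4 :=
    (pow_le_pow_of_le_one (by norm_num) (by norm_num) c.le_succ).trans_lt hc
  obtain ⟨N, hN⟩ := eventually_le_of_norm_shift_pow_sub_lt (envelope_zero _) hB x hu (2 * (c + 1))
  have hlim : ∀ᶠ n : ℕ in atTop, (N + 1) / (ε / 2) ≤ (n : ℝ) :=
    tendsto_natCast_atTop_atTop.eventually_ge_atTop _
  filter_upwards [hlim] with n hn
  rw [div_le_iff₀ (by positivity)] at hn
  have h1 := ncard_envelope_ge_le a b c.succ_pos n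
  have hsub : {n | ‖(B ^ n) x - u‖ < 1 / 2} ∩ Set.Icc 0 n ⊆ Set.Icc 0 N ∪
      ({j | 2 * (c + 1) ≤ envelope (ZoneBound a b) j} ∩ Set.Icc 0 n) := by
    rintro j ⟨hj, hjn⟩
    rcases le_total j N with h | h
    · exact Or.inl ⟨Nat.zero_le _, h⟩
    · exact Or.inr ⟨hN j h hj, hjn⟩
  have h2 := (Set.ncard_le_ncard hsub ((Set.finite_Icc _ _).union
    ((Set.finite_Icc _ _).inter_of_right _))).trans (Set.ncard_union_le _ _)
  have h3 : (Set.Icc 0 N).ncard = N + 1 := by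
    rw [← Finset.coe_Icc, Set.ncard_coe_finset, Nat.card_Icc, Nat.sub_zero]
  rw [h3] at h2
  have h4 : (({n | ‖(B ^ n) x - u‖ < 1 / 2} ∩ Set.Icc 0 n).ncard : ℝ) ≤ (N + 1) +
      ({j | 2 * (c + 1) ≤ envelope (ZoneBound a b) j} ∩ Set.Icc 0 n).ncard := by exact_mod_cast h2
  have h5 : 2 * (1 / 2) ^ (c + 1) * (n : ℝ) ≤ ε / 2 * n := by
    gcongr
    linarith
  simp only [Nat.succ_eq_add_one] at h1
  linarith

/-! ### The two examples on `c₀(ℕ) ⊕ ℂ` -/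

/-- The first unit vector of `c₀(ℕ)`. -/
noncomputable def cZero.unit : cZero :=
  cZero.mk (fun n => if n = 0 then 1 else 0) (tendsto_const_nhds.congr' (by
    filter_upwards [eventually_gt_atTop 0] with n hn
    rw [if_neg hn.ne']))

@[simp] lemma cZero.unit_zero : cZero.unit 0 = 1 := rfl

lemma frequently_unpair_fst_eq (p : ℕ) : ∃ᶠ l : ℕ in atTop, l.unpair.1 = p :=
  frequently_atTop.2 fun m => ⟨Nat.pair p m, Nat.right_le_pair p m, by rw [Nat.unpair_pair]⟩

lemma le_factorial_two_mul_add_one (l : ℕ) : 2 * l + 1 ≤ (2 * l + 1)! := Nat.self_le_factorial _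

lemma factorial_two_mul_add_two (l : ℕ) : (2 * l + 2)! = (2 * l + 2) * (2 * l + 1)! := rfl

lemma factorial_two_mul_add_three (l : ℕ) :
    (2 * (l + 1) + 1)! = (2 * l + 3) * (2 * l + 2)! := rfl

lemma factorial_two_mul_succ_add_two (l : ℕ) :
    (2 * (l + 1) + 2)! = (2 * l + 4) * ((2 * l + 3) * (2 * l + 2)!) := rfl

lemma le_factorial_two_mul_add_two (l : ℕ) : 2 * l + 2 ≤ (2 * l + 2)! := Nat.self_le_factorial _

lemma isZoneSequence_long :
    IsZoneSequence (fun l => (2 * l + 2)!) (fun l => (2 * l + 1)!) where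
  pos l := Nat.factorial_pos _
  two_mul_le l := by have := le_factorial_two_mul_add_two l; omega
  add_two_le l := by
    simp only [factorial_two_mul_succ_add_two]
    have := le_factorial_two_mul_add_two l
    nlinarith [Nat.zero_le (l * (2 * l + 2)!), Nat.zero_le (l * (l * (2 * l + 2)!))]
  right_le_left l := Nat.factorial_le (by omega)
  add_le l := by
    simp only [factorial_two_mul_add_three]
    have : (2 * l + 1)! ≤ (2 * l + 2)! := Nat.factorial_le (by omega)
    nlinarith [Nat.zero_le (l * (2 * l + 2)!)]

/-- Right endpoints of zones which are short compared to their position. -/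
def shortZoneEnd : ℕ → ℕ
  | 0 => 0
  | l + 1 => (2 * l + 2)! + (2 * l + 1)!

/-- After its left part is removed, the `l`-th short zone still has length at least `l`, so
arbitrarily long windows fit inside. -/
lemma shortZoneEnd_add_le (l : ℕ) : shortZoneEnd l + l ≤ (2 * l + 1)! := by
  cases l with
  | zero => simp [shortZoneEnd]
  | succ k =>
    rw [shortZoneEnd, factorial_two_mul_add_three]
    have h1 : (2 * k + 1)! ≤ (2 * k + 2)! := Nat.factorial_le (by omega)
    have h2 := le_factorial_two_mul_add_two k
    nlinarith [Nat.zero_le (k * (2 * k + 2)!)]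

lemma isZoneSequence_short : IsZoneSequence (fun l => (2 * l + 2)!) shortZoneEnd where
  pos l := Nat.factorial_pos _
  two_mul_le := isZoneSequence_long.two_mul_le
  add_two_le := isZoneSequence_long.add_two_le
  right_le_left l := by
    have := shortZoneEnd_add_le l
    have h : (2 * l + 1)! ≤ (2 * l + 2)! := Nat.factorial_le (by omega)
    omega
  add_le l := by
    have := shortZoneEnd_add_le l
    rw [shortZoneEnd]
    omega

lemma IsZoneSequence.zoneNhd_inter_subset {a b : ℕ → ℕ} (h : IsZoneSequence a b) {l n : ℕ}
    (hn : n + 2 * l < a l) : zoneNhd a b ∩ Set.Icc 0 n ⊆ Set.Icc 0 (b l) := by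
  rintro j ⟨⟨k, hk1, hk2⟩, -, hjn⟩
  refine ⟨Nat.zero_le _, ?_⟩
  rcases lt_or_ge k l with hkl | hkl
  · exact hk2.trans (h.monotone_right hkl)
  · obtain ⟨i, rfl⟩ := Nat.exists_eq_add_of_le hkl
    have := h.left_add_le l i
    omega

lemma IsZoneSequence.zoneNhd_inter_subset_union {a b : ℕ → ℕ} (h : IsZoneSequence a b) {l n : ℕ}
    (hn : n + 2 * (l + 1) < a (l + 1)) :
    zoneNhd a b ∩ Set.Icc 0 n ⊆ Set.Icc 0 (b l) ∪ Set.Icc (a l - 2 * l) (b (l + 1)) := by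
  rintro j ⟨⟨k, hk1, hk2⟩, -, hjn⟩
  rcases lt_trichotomy k l with hkl | rfl | hkl
  · exact Or.inl ⟨Nat.zero_le _, hk2.trans (h.monotone_right hkl)⟩
  · exact Or.inr ⟨by omega, hk2⟩
  · obtain ⟨i, rfl⟩ := Nat.exists_eq_add_of_le (show l + 1 ≤ k from hkl)
    have := h.left_add_le (l + 1) i
    omega

lemma ncard_Icc_nat (m n : ℕ) : (Set.Icc m n).ncard = n + 1 - m := by
  rw [← Finset.coe_Icc, Set.ncard_coe_finset, Nat.card_Icc]

theorem exists_isUFrequentlySupercyclic_not_isFrequentlySupercyclic :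
    ∃ (w : ℕ → ℝ) (B : cZero →L[ℂ] cZero), IsWeight w ∧ IsBackwardShiftCZero w B ∧
      IsUFrequentlySupercyclic (sumId B) ∧ ¬ IsFrequentlySupercyclic (sumId B) := by
  have h := isZoneSequence_long
  have hf := envelope_succ_le h.le_of_zoneBound
  obtain ⟨B, hB⟩ := exists_isBackwardShiftCZero hf
  refine ⟨_, B, isWeight_stepWeight hf, hB, ?_, ?_⟩
  · rw [isUFrequentlySupercyclic_sumId_iff]
    obtain ⟨x, hx⟩ := exists_vector_visiting_zones h hB
    refine ⟨x, fun u δ hδ => ?_⟩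
    obtain ⟨p, hp⟩ := hx u δ hδ
    have hg := period_pos p
    have hg' : (0 : ℝ) < period p := by exact_mod_cast hg
    refine lt_of_lt_of_le (show (0 : ℝ) < 1 / (8 * period p) by positivity)
      (le_upperDensity_of_frequently ?_)
    have hfreq : ∃ᶠ l : ℕ in atTop,
        1 / (8 * period p) * (((2 * (l + 1) + 1)! : ℕ) : ℝ) ≤
        ({n | ‖(B ^ n) x - u‖ < δ} ∩ Set.Icc 0 (2 * (l + 1) + 1)!).ncard := by
      refine ((frequently_unpair_fst_eq p).and_eventually
        (eventually_ge_atTop (3 + 4 * period p))).mono fun l hl => ?_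
      obtain ⟨hlp, hlarge⟩ := hl
      set N := (2 * (l + 1) + 1)! with hN
      set e := (2 * l + 2)! + (2 * l + 1)! with he
      set k := period p * (e / period p + 1) with hk
      have hke : e ≤ k := (Nat.lt_mul_div_succ e hg).le
      have hke' : k ≤ e + period p := by
        rw [hk, mul_add, mul_one]
        exact Nat.add_le_add_right (Nat.mul_div_le _ _) _
      have heN : 4 * e ≤ N := by
        rw [hN, factorial_two_mul_add_three]
        have : (2 * l + 1)! ≤ (2 * l + 2)! := Nat.factorial_le (by omega)
        nlinarith
      have hNg : 4 * period p ≤ N := by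
        have := le_factorial_two_mul_add_one (l + 1)
        omega
      have hcount := div_le_ncard_of_dvd (E := {n | ‖(B ^ n) x - u‖ < δ}) (k := k)
        (s := N - e - 2 * period p) hg (dvd_mul_right _ _)
        fun n h1 h2 h3 => hp l n hlp h1 (by omega) (show n + period p ≤ N by omega)
      have hsub : {n | ‖(B ^ n) x - u‖ < δ} ∩ Set.Icc (k + 1) (k + (N - e - 2 * period p)) ⊆
          {n | ‖(B ^ n) x - u‖ < δ} ∩ Set.Icc 0 N :=
        Set.inter_subset_inter_right _ (Set.Icc_subset_Icc (Nat.zero_le _) (by omega))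
      have hcount' := hcount.trans
        (Set.ncard_le_ncard hsub ((Set.finite_Icc _ _).inter_of_right _))
      -- The usable part of the zone has length at least `N / 4`, and rounding down to whole periods
      -- loses at most another factor 2.
      have hdiv : N ≤ 8 * period p * ((N - e - 2 * period p) / period p) := by
        have h1 : period p ≤ N - e - 2 * period p := by omega
        have h2 := Nat.lt_mul_div_succ (N - e - 2 * period p) hg
        have h3 : 1 ≤ (N - e - 2 * period p) / period p := (Nat.one_le_div_iff hg).2 h1
        set q := (N - e - 2 * period p) / period p
        have h4 : period p ≤ period p * q := Nat.le_mul_of_pos_right _ h3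
        rw [mul_add, mul_one] at h2
        rw [mul_assoc]
        omega
      rw [one_div, inv_mul_le_iff₀ (by positivity)]
      exact_mod_cast hdiv.trans (Nat.mul_le_mul_left _ hcount')
    exact (tendsto_atTop_mono (fun l => by
      have := le_factorial_two_mul_add_one (l + 1); rw [id]; omega) tendsto_id).frequently hfreq
  · rw [isFrequentlySupercyclic_sumId_iff]
    rintro ⟨x, hx⟩
    refine (hx cZero.unit (1 / 2) one_half_pos).not_ge ?_
    refine le_of_forall_pos_le_add fun ε hε => ?_
    rw [zero_add]
    refine lowerDensity_le_of_frequently ?_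
    have hbound := eventually_ncard_returns_le hB x cZero.unit_zero (half_pos hε)
    -- These are the last integers before the neighbourhood of zone `l` begins; everything earlier
    -- near the zones lies below `(2 * l + 1)!`.
    have hlim : Tendsto (fun l : ℕ => (2 * l + 2)! - 2 * l - 1) atTop atTop :=
      tendsto_atTop_mono (fun l => by
        have := factorial_two_mul_add_two l
        have := le_factorial_two_mul_add_one l
        have : 2 * (2 * l + 1)! ≤ (2 * l + 2) * (2 * l + 1)! :=
          Nat.mul_le_mul_right _ (by omega)
        rw [id]; omega) tendsto_id
    refine hlim.frequently (Eventually.frequently ?_)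
    have hε' : ∀ᶠ l : ℕ in atTop, 8 / ε ≤ (l : ℝ) :=
      tendsto_natCast_atTop_atTop.eventually_ge_atTop _
    filter_upwards [hlim.eventually hbound, hε'] with l hl hlε
    refine hl.trans ?_
    set n := (2 * l + 2)! - 2 * l - 1 with hn
    have h1 := le_factorial_two_mul_add_one l
    have h2 := factorial_two_mul_add_two l
    have h3 := Nat.mul_le_mul_right (2 * l + 1)! (show 2 ≤ 2 * l + 2 by omega)
    have h4 := Set.ncard_le_ncard (h.zoneNhd_inter_subset (l := l) (n := n) (by omega)) (Set.finite_Icc _ _)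
    rw [ncard_Icc_nat] at h4
    have h5 : l * (2 * l + 1)! ≤ n := by
      have : (2 * l + 2) * (2 * l + 1)! = l * (2 * l + 1)! + (l + 2) * (2 * l + 1)! := by ring
      have := Nat.mul_le_mul_right (2 * l + 1)! (show 2 ≤ l + 2 by omega)
      omega
    have h6 : (zoneNhd (fun l => (2 * l + 2)!) (fun l => (2 * l + 1)!) ∩ Set.Icc 0 n).ncard ≤
        2 * (2 * l + 1)! := by omega
    have h7 : ((zoneNhd (fun l => (2 * l + 2)!) (fun l => (2 * l + 1)!) ∩
        Set.Icc 0 n).ncard : ℝ) ≤ 2 * ((2 * l + 1)! : ℕ) := by exact_mod_cast h6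
    have h8 : (l : ℝ) * ((2 * l + 1)! : ℕ) ≤ n := by exact_mod_cast h5
    rw [div_le_iff₀ hε] at hlε
    have h9 : (0 : ℝ) ≤ ((2 * l + 1)! : ℕ) := Nat.cast_nonneg _
    nlinarith [mul_le_mul_of_nonneg_right hlε h9, mul_le_mul_of_nonneg_left h8 hε.le]

theorem exists_isReiterativelySupercyclic_not_isUFrequentlySupercyclic :
    ∃ (w : ℕ → ℝ) (B : cZero →L[ℂ] cZero), IsWeight w ∧ IsBackwardShiftCZero w B ∧
      IsReiterativelySupercyclic (sumId B) ∧ ¬ IsUFrequentlySupercyclic (sumId B) := by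
  have h := isZoneSequence_short
  have hf := envelope_succ_le h.le_of_zoneBound
  obtain ⟨B, hB⟩ := exists_isBackwardShiftCZero hf
  refine ⟨_, B, isWeight_stepWeight hf, hB, ?_, ?_⟩
  · rw [isReiterativelySupercyclic_sumId_iff]
    obtain ⟨x, hx⟩ := exists_vector_visiting_zones h hB
    refine ⟨x, fun u δ hδ => ?_⟩
    obtain ⟨p, hp⟩ := hx u δ hδ
    have hg := period_pos p
    have hg' : (0 : ℝ) < period p := by exact_mod_cast hg
    refine lt_of_lt_of_le (show (0 : ℝ) < 1 / (2 * period p) by positivity)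
      (le_upperBanachDensity ?_)
    filter_upwards [eventually_ge_atTop (period p)] with s hs
    refine frequently_atTop.2 fun K => ?_
    obtain ⟨l, hl, hlp⟩ := frequently_atTop.1 (frequently_unpair_fst_eq p)
      (K + s + 2 * period p)
    set e := (2 * l + 2)! + shortZoneEnd l with he
    set k := period p * (e / period p + 1) with hk
    have hke : e ≤ k := (Nat.lt_mul_div_succ e hg).le
    have hke' : k ≤ e + period p := by
      rw [hk, mul_add, mul_one]
      exact Nat.add_le_add_right (Nat.mul_div_le _ _) _
    have hend : shortZoneEnd (l + 1) = (2 * l + 2)! + (2 * l + 1)! := rfl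
    have hroom := shortZoneEnd_add_le l
    have hcount := div_le_ncard_of_dvd (E := {n | ‖(B ^ n) x - u‖ < δ}) (k := k)
      (s := s) hg (dvd_mul_right _ _)
      fun n h1 h2 h3 => hp l n hlp h1 (by omega) (by omega)
    have hKk : K ≤ k := by
      have := le_factorial_two_mul_add_two l
      omega
    refine ⟨k, hKk, ?_⟩
    have hdiv : s ≤ 2 * period p * (s / period p) := by
      have h2 := Nat.lt_mul_div_succ s hg
      have h3 : 1 ≤ s / period p := (Nat.one_le_div_iff hg).2 hs
      set q := s / period p
      have h4 : period p ≤ period p * q := Nat.le_mul_of_pos_right _ h3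
      rw [mul_add, mul_one] at h2
      rw [mul_assoc]
      omega
    rw [one_div, inv_mul_le_iff₀ (by positivity)]
    exact_mod_cast hdiv.trans (Nat.mul_le_mul_left _ hcount)
  · rw [isUFrequentlySupercyclic_sumId_iff]
    rintro ⟨x, hx⟩
    refine (hx cZero.unit (1 / 2) one_half_pos).not_ge ?_
    refine le_of_forall_pos_le_add fun ε hε => ?_
    rw [zero_add]
    refine upperDensity_le_of_eventually ?_
    have hbound := eventually_ncard_returns_le hB x cZero.unit_zero (half_pos hε)
    obtain ⟨L, hL⟩ := exists_nat_ge (8 / ε)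
    filter_upwards [hbound, eventually_ge_atTop (2 * L + 2)!] with n hn hnL
    refine hn.trans ?_
    -- Take `l + 1` to be the first index whose zone neighbourhood starts after `n`.
    obtain ⟨l, hLl, hl1, hl2⟩ : ∃ l, L ≤ l ∧ (2 * l + 2)! ≤ n + 2 * l ∧
        n + 2 * (l + 1) < (2 * (l + 1) + 2)! := by
      have hex : ∃ k, n + 2 * k < (2 * k + 2)! := by
        refine ⟨n + 1, ?_⟩
        have h2 := factorial_two_mul_add_two (n + 1)
        have h3 := le_factorial_two_mul_add_one (n + 1)
        have h4 := Nat.mul_le_mul_right (2 * (n + 1) + 1)! (show 2 ≤ 2 * (n + 1) + 2 by omega)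
        omega
      classical
      have hspec := Nat.find_spec hex
      have hLlt : L < Nat.find hex := by
        by_contra hle
        have := h.monotone_left (not_lt.1 hle)
        omega
      obtain ⟨l, hl⟩ := Nat.exists_eq_add_of_lt hLlt
      have hmin := Nat.find_min hex (m := L + l) (by omega)
      rw [hl] at hspec
      exact ⟨L + l, by omega, by omega, hspec⟩
    have h1 := le_factorial_two_mul_add_one l
    have h2 := factorial_two_mul_add_two l
    have h4 := (Set.ncard_le_ncard (h.zoneNhd_inter_subset_union hl2)
      ((Set.finite_Icc _ _).union (Set.finite_Icc _ _))).trans (Set.ncard_union_le _ _)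
    have hend : shortZoneEnd (l + 1) = (2 * l + 2)! + (2 * l + 1)! := rfl
    have hroom := shortZoneEnd_add_le l
    rw [ncard_Icc_nat, ncard_Icc_nat, hend] at h4
    have h5 : l * (2 * l + 1)! ≤ n := by
      have : (2 * l + 2) * (2 * l + 1)! = l * (2 * l + 1)! + (l + 2) * (2 * l + 1)! := by ring
      have := Nat.mul_le_mul_right (2 * l + 1)! (show 2 ≤ l + 2 by omega)
      omega
    have h6 : (zoneNhd (fun l => (2 * l + 2)!) shortZoneEnd ∩ Set.Icc 0 n).ncard ≤
        4 * (2 * l + 1)! := by omega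
    have h7 : ((zoneNhd (fun l => (2 * l + 2)!) shortZoneEnd ∩
        Set.Icc 0 n).ncard : ℝ) ≤ 4 * ((2 * l + 1)! : ℕ) := by exact_mod_cast h6
    have h8 : (l : ℝ) * ((2 * l + 1)! : ℕ) ≤ n := by exact_mod_cast h5
    have hlε : 8 / ε ≤ (l : ℝ) := hL.trans (by exact_mod_cast hLl)
    rw [div_le_iff₀ hε] at hlε
    have h9 : (0 : ℝ) ≤ ((2 * l + 1)! : ℕ) := Nat.cast_nonneg _
    nlinarith [mul_le_mul_of_nonneg_right hlε h9, mul_le_mul_of_nonneg_left h8 hε.le]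

/-! ### The example on `ℓ_p(ℕ) ⊕ ℂ` -/

/-- A form of the hypercyclicity criterion. -/
theorem exists_dense_orbit {X : Type*} [NormedAddCommGroup X] [NormedSpace ℂ X] [CompleteSpace X]
    [TopologicalSpace.SeparableSpace X] {B : X →L[ℂ] X} {D : Set X} (hD : Dense D)
    (hzero : ∀ v ∈ D, ∃ N, ∀ n, N ≤ n → (B ^ n) v = 0)
    (hinv : ∀ z ∈ D, ∀ (ε : ℝ) (N : ℕ), 0 < ε → ∃ n, N ≤ n ∧ ∃ u, ‖u‖ < ε ∧ (B ^ n) u = z) :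
    ∃ x : X, ∀ (u : X) (δ : ℝ), 0 < δ → {n | ‖(B ^ n) x - u‖ < δ}.Nonempty := by
  let d : ℕ → X := TopologicalSpace.denseSeq X
  have hd : DenseRange d := TopologicalSpace.denseRange_denseSeq X
  let V : ℕ × ℕ → Set X := fun i => ⋃ n, {x | ‖(B ^ n) x - d i.1‖ < 1 / (i.2 + 1)}
  have hVo (i : ℕ × ℕ) : IsOpen (V i) := isOpen_iUnion fun n =>
    isOpen_lt (((B ^ n).continuous.sub continuous_const).norm) continuous_const
  have hVd (i : ℕ × ℕ) : Dense (V i) := by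
    refine Metric.dense_iff.2 fun x r hr => ?_
    obtain ⟨v, hv, hxv⟩ := hD.exists_dist_lt x (half_pos hr)
    obtain ⟨z, hz, hzd⟩ := hD.exists_dist_lt (d i.1) (show (0 : ℝ) < 1 / (i.2 + 1) by positivity)
    obtain ⟨N, hN⟩ := hzero v hv
    obtain ⟨n, hn, u, hu, hBu⟩ := hinv z hz (r / 2) N (half_pos hr)
    -- At time `n` the vector `v` has been annihilated, and the small perturbation `u` has become
    -- `z`.
    refine ⟨v + u, ?_, Set.mem_iUnion.2 ⟨n, ?_⟩⟩
    · rw [Metric.mem_ball, dist_eq_norm, show v + u - x = u - (x - v) by abel]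
      rw [dist_eq_norm] at hxv
      linarith [norm_sub_le u (x - v)]
    · change ‖(B ^ n) (v + u) - d i.1‖ < _
      rw [map_add, hN n hn, zero_add, hBu, norm_sub_rev, ← dist_eq_norm]
      exact hzd
  obtain ⟨x, hx⟩ := (dense_iInter_of_isOpen hVo hVd).nonempty
  refine ⟨x, fun u δ hδ => ?_⟩
  obtain ⟨i, hi⟩ := hd.exists_dist_lt u (half_pos hδ)
  obtain ⟨m, hm⟩ := exists_nat_one_div_lt (half_pos hδ)
  obtain ⟨n, hn⟩ := Set.mem_iUnion.1 (Set.mem_iInter.1 hx (i, m))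
  refine ⟨n, ?_⟩
  change ‖(B ^ n) x - d i‖ < _ at hn
  change ‖(B ^ n) x - u‖ < δ
  rw [dist_eq_norm] at hi
  rw [show (B ^ n) x - u = ((B ^ n) x - d i) - (u - d i) by abel]
  linarith [norm_sub_le ((B ^ n) x - d i) (u - d i)]

section EllP

variable {p : ENNReal} [Fact (1 ≤ p)]

lemma separableSpace_ellP (hp : p ≠ ⊤) : TopologicalSpace.SeparableSpace (ellP p) := by
  rw [← TopologicalSpace.isSeparable_univ_iff]
  have hs : TopologicalSpace.IsSeparable
      (Submodule.span ℂ (Set.range fun n => (lp.single p n (1 : ℂ) : ellP p)) : Set (ellP p)) :=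
    (Set.countable_range _).isSeparable.span
  refine hs.closure.mono fun x _ => ?_
  refine mem_closure_of_tendsto (lp.hasSum_single hp x) (Eventually.of_forall fun s => ?_)
  refine Submodule.sum_mem _ fun n _ => ?_
  have : (lp.single p n (x n) : ellP p) = x n • lp.single p n (1 : ℂ) := by
    rw [← lp.single_smul, smul_eq_mul, mul_one]
  rw [this]
  exact Submodule.smul_mem _ _ (Submodule.subset_span ⟨n, rfl⟩)

lemma dense_finite_support_ellP (hp : p ≠ ⊤) :
    Dense {x : ellP p | ∃ K, ∀ k, K ≤ k → x k = 0} := fun x => by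
  refine mem_closure_of_tendsto (lp.hasSum_single hp x).tendsto_sum_nat
    (Eventually.of_forall fun K => ⟨K, fun k hk => ?_⟩)
  rw [lp.coeFn_sum, Finset.sum_apply]
  refine Finset.sum_eq_zero fun i hi => ?_
  rw [lp.single_apply_ne]
  have := Finset.mem_range.1 hi
  omega

lemma exists_small_preimage {f : ℕ → ℕ} {B : ellP p →L[ℂ] ellP p}
    (hB : IsBackwardShiftEllP (stepWeight f) B)
    (hf : ∀ K M N : ℕ, ∃ n, N ≤ n ∧ ∀ k < K, M ≤ f (n + k)) {z : ellP p} {K : ℕ}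
    (hz : ∀ k, K ≤ k → z k = 0) {ε : ℝ} (hε : 0 < ε) (N : ℕ) :
    ∃ n, N ≤ n ∧ ∃ u, ‖u‖ < ε ∧ (B ^ n) u = z := by
  obtain ⟨M, hM⟩ := pow_unbounded_of_one_lt
    ((∑ k ∈ Finset.range K, 2 ^ f k * ‖z k‖) / ε) one_lt_two
  obtain ⟨n, hn, hfn⟩ := hf K M N
  refine ⟨n, hn, ∑ k ∈ Finset.range K, lp.single p (n + k) (2 ^ f k / 2 ^ f (n + k) * z k),
    ?_, ?_⟩
  · refine lt_of_le_of_lt (norm_sum_le _ _) ?_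
    calc _ ≤ ∑ k ∈ Finset.range K, (2 ^ f k * ‖z k‖) / 2 ^ M := by
          refine Finset.sum_le_sum fun k hk => ?_
          rw [lp.norm_single (zero_lt_one.trans_le Fact.out), norm_mul, norm_div, norm_pow,
            norm_pow, Complex.norm_ofNat, div_mul_eq_mul_div]
          gcongr
          · exact one_le_two
          · exact hfn k (Finset.mem_range.1 hk)
      _ < ε := by
          rw [← Finset.sum_div, div_lt_iff₀ (by positivity)]
          rwa [div_lt_iff₀ hε, mul_comm] at hM
  · ext k
    rw [shift_pow_apply (coord := fun (x : ellP p) n => x n) hB, lp.coeFn_sum, Finset.sum_apply]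
    have h1 : (2 : ℂ) ^ f k ≠ 0 := pow_ne_zero _ two_ne_zero
    have h2 : (2 : ℂ) ^ f (n + k) ≠ 0 := pow_ne_zero _ two_ne_zero
    rcases lt_or_ge k K with hk | hk
    · rw [Finset.sum_eq_single_of_mem k (Finset.mem_range.2 hk) fun i _ hi =>
        lp.single_apply_ne _ _ _ (by omega), lp.single_apply_self]
      field_simp
    · rw [Finset.sum_eq_zero fun i hi => lp.single_apply_ne _ _ _ (by
        have := Finset.mem_range.1 hi
        omega), mul_zero, hz k hk]

/-- Both returns read the same entry `x m`: the later one gives `2 ^ f m * ‖x m‖ > 2 / 3`, and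
coordinate `m - n` of the earlier one gives `2 ^ f m * ‖x m‖ < 2 ^ f (m - n) / 3`. -/
lemma exponent_pos_of_norm_shift_pow_sub_lt {f : ℕ → ℕ} (hf0 : f 0 = 0) {B : ellP p →L[ℂ] ellP p}
    (hB : IsBackwardShiftEllP (stepWeight f) B) (x : ellP p) {m n : ℕ} (hmn : n < m)
    (hn : ‖(B ^ n) x - lp.single p 0 (1 : ℂ)‖ < 1 / 3)
    (hm : ‖(B ^ m) x - lp.single p 0 (1 : ℂ)‖ < 1 / 3) : 0 < f (m - n) := by
  have hp0 : p ≠ 0 := (zero_lt_one.trans_le (Fact.out : 1 ≤ p)).ne'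
  have h1 := (lp.norm_apply_le_norm hp0 _ 0).trans_lt hm
  have h2 := (lp.norm_apply_le_norm hp0 _ (m - n)).trans_lt hn
  rw [lp.coeFn_sub, Pi.sub_apply, shift_pow_apply (coord := fun (x : ellP p) n => x n) hB] at h1 h2
  rw [lp.single_apply_self, hf0, pow_zero, div_one, add_zero] at h1
  rw [lp.single_apply_ne _ _ _ (by omega), sub_zero, Nat.add_sub_cancel' hmn.le] at h2
  by_contra h
  rw [Nat.eq_zero_of_not_pos h, pow_zero, div_one] at h2
  have h4 := norm_sub_norm_le (1 : ℂ) (2 ^ f m * x m)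
  rw [norm_sub_rev, norm_one] at h4
  linarith

end EllP

/-- Lower bounds for the exponents: `r` at `r ^ 4`. -/
def FourthPowerBound (i r : ℕ) : Prop := i = r ^ 4

lemma le_of_fourthPowerBound (i r : ℕ) (h : FourthPowerBound i r) : r ≤ i :=
  h ▸ Nat.le_self_pow four_ne_zero r

lemma exists_window_envelope_fourthPower (K M N : ℕ) :
    ∃ n, N ≤ n ∧ ∀ k < K, M ≤ envelope FourthPowerBound (n + k) := by
  set r := K + M + N with hr
  have hle : r ≤ r ^ 4 := Nat.le_self_pow four_ne_zero r
  -- Since the exponent climbs by at most one per step and reaches `r` at `r ^ 4`, it is at least `r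
  -- - K` on the `K` preceding integers.
  refine ⟨r ^ 4 - K, by omega, fun k hk => ?_⟩
  have h1 : r ≤ envelope FourthPowerBound (r ^ 4) :=
    le_envelope le_of_fourthPowerBound rfl
  have h2 := envelope_add_le le_of_fourthPowerBound (r ^ 4 - K + k) (K - k)
  rw [show r ^ 4 - K + k + (K - k) = r ^ 4 by omega] at h2
  omega

/-- The ramp before `r ^ 4` is shorter than `r`, hence stays above `(r - 1) ^ 4`; this bounds `r` by
`M`. -/
lemma exists_of_envelope_fourthPower_pos {j M : ℕ} (hj : j ≤ M ^ 4)
    (h : 0 < envelope FourthPowerBound j) :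
    ∃ r t, r ≤ M ∧ t ≤ M ∧ j = r ^ 4 - t := by
  obtain ⟨t, ht⟩ := exists_of_envelope_pos h
  change j + t = _ at ht
  obtain ⟨q, hq⟩ := Nat.exists_eq_add_of_lt (show t < envelope FourthPowerBound j + t by omega)
  rw [hq] at ht
  have h1 : (t + q + 1) ^ 4 = (t + q) ^ 4 + 4 * (t + q) ^ 3 + 6 * (t + q) ^ 2 + 4 * (t + q) + 1 := by
    ring
  have h2 : t + q < M := lt_of_pow_lt_pow_left₀ 4 (Nat.zero_le _) (by omega)
  exact ⟨t + q + 1, t, h2, by omega, by omega⟩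

/-- Measured from the least element of a window of length `M ^ 4`, every element is given by a pair
`(r, t)` with `r, t ≤ M`. Thus the window has at most `(M + 1) ^ 2` elements, too few for any
positive density. -/
lemma upperBanachDensity_le_zero_of_differences {E : Set ℕ}
    (hE : ∀ n ∈ E, ∀ m ∈ E, n < m → 0 < envelope FourthPowerBound (m - n)) :
    upperBanachDensity E ≤ 0 := by
  by_contra! hpos
  obtain ⟨c, hc0, hc⟩ := exists_between hpos
  have hpow : Tendsto (fun M : ℕ => M ^ 4) atTop atTop := tendsto_pow_atTop four_ne_zero
  have hlim : ∀ᶠ M : ℕ in atTop, 4 / c ≤ (M : ℝ) :=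
    tendsto_natCast_atTop_atTop.eventually_ge_atTop _
  obtain ⟨M, hM, hM1, hMc⟩ := ((hpow.eventually
    (eventually_frequently_of_lt_upperBanachDensity hc)).and
    ((eventually_ge_atTop 1).and hlim)).exists
  obtain ⟨k, hk⟩ := hM.exists
  set W := E ∩ Set.Icc (k + 1) (k + M ^ 4) with hW
  have hne : W.Nonempty := by
    rw [Set.nonempty_iff_ne_empty]
    intro h0
    rw [h0, Set.ncard_empty, Nat.cast_zero] at hk
    exact absurd hk (by positivity : (0 : ℝ) ≤ c * _).not_gt
  classical
  have hmin := Nat.sInf_mem hne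
  set n₀ := sInf W
  let S : Finset ℕ := (Finset.range (M + 1) ×ˢ Finset.range (M + 1)).image
    fun i => n₀ + (i.1 ^ 4 - i.2)
  have hsub : W ⊆ S := by
    intro m hm
    have hle : n₀ ≤ m := Nat.sInf_le hm
    obtain ⟨r, t, hr, ht, heq⟩ : ∃ r t, r ≤ M ∧ t ≤ M ∧ m - n₀ = r ^ 4 - t := by
      rcases hle.eq_or_lt with heq | hlt
      · exact ⟨0, 0, by omega, by omega, by simp [heq]⟩
      · refine exists_of_envelope_fourthPower_pos ?_ (hE _ hmin.1 _ hm.1 hlt)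
        have := hm.2.2
        have := hmin.2.1
        omega
    simp only [S, Finset.coe_image, Set.mem_image, Finset.mem_coe, Finset.mem_product,
      Finset.mem_range]
    exact ⟨(r, t), ⟨by omega, by omega⟩, by simp only [← heq]; omega⟩
  have hcard : W.ncard ≤ (M + 1) * (M + 1) := by
    have h1 := Set.ncard_le_ncard hsub S.finite_toSet
    rw [Set.ncard_coe_finset] at h1
    refine h1.trans (Finset.card_image_le.trans ?_)
    rw [Finset.card_product, Finset.card_range]
  have hcard' : (W.ncard : ℝ) ≤ (M + 1) * (M + 1) := by exact_mod_cast hcard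
  have hM1' : (1 : ℝ) ≤ M := by exact_mod_cast hM1
  rw [div_le_iff₀ hc0] at hMc
  push_cast at hk
  have h1 : (4 : ℝ) * M ^ 3 ≤ c * M ^ 4 := by
    calc (4 : ℝ) * M ^ 3 ≤ M * c * M ^ 3 := by gcongr
      _ = c * M ^ 4 := by ring
  nlinarith [mul_le_mul_of_nonneg_left hM1' (sq_nonneg (M : ℝ))]

theorem exists_isSupercyclic_not_isReiterativelySupercyclic (p : ENNReal) [Fact (1 ≤ p)]
    (hp : p ≠ ⊤) : ∃ (w : ℕ → ℝ) (B : ellP p →L[ℂ] ellP p), IsWeight w ∧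
      IsBackwardShiftEllP w B ∧ IsSupercyclic (sumId B) ∧
        ¬ IsReiterativelySupercyclic (sumId B) := by
  have hf := envelope_succ_le le_of_fourthPowerBound
  obtain ⟨B, hB⟩ := exists_isBackwardShiftEllP hp hf
  refine ⟨_, B, isWeight_stepWeight hf, hB, ?_, ?_⟩
  · rw [isSupercyclic_sumId_iff]
    have := separableSpace_ellP hp
    refine exists_dense_orbit (dense_finite_support_ellP hp) ?_ ?_
    · rintro v ⟨K, hK⟩
      refine ⟨K, fun n hn => ?_⟩
      ext k
      rw [shift_pow_apply (coord := fun (x : ellP p) n => x n) hB, hK _ (by omega), mul_zero]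
      rfl
    · rintro z ⟨K, hK⟩ ε N hε
      exact exists_small_preimage hB exists_window_envelope_fourthPower hK hε N
  · rw [isReiterativelySupercyclic_sumId_iff]
    rintro ⟨x, hx⟩
    refine (hx (lp.single p 0 1) (1 / 3) (by norm_num)).not_ge ?_
    exact upperBanachDensity_le_zero_of_differences fun n hn m hm hnm =>
      exponent_pos_of_norm_shift_pow_sub_lt (envelope_zero _) hB x hnm hn hm

end LinearDynamics

theorem corollary2p2 :
    -- the inclusions, on every complex Banach space
    (∀ (X : Type u) [NormedAddCommGroup X] [NormedSpace ℂ X] [CompleteSpace X],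
      {T : X →L[ℂ] X | IsFrequentlySupercyclic T} ⊆ {T | IsUFrequentlySupercyclic T} ∧
      {T : X →L[ℂ] X | IsUFrequentlySupercyclic T} ⊆ {T | IsReiterativelySupercyclic T} ∧
      {T : X →L[ℂ] X | IsReiterativelySupercyclic T} ⊆ {T | IsSupercyclic T}) ∧
    -- the first inclusion is strict on `c₀(ℕ) ⊕ ℂ`
    (∃ (w : ℕ → ℝ) (B : cZero →L[ℂ] cZero), IsWeight w ∧ IsBackwardShiftCZero w B ∧
      IsUFrequentlySupercyclic (sumId B) ∧ ¬ IsFrequentlySupercyclic (sumId B)) ∧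
    -- the second inclusion is strict on `c₀(ℕ) ⊕ ℂ`
    (∃ (w : ℕ → ℝ) (B : cZero →L[ℂ] cZero), IsWeight w ∧ IsBackwardShiftCZero w B ∧
      IsReiterativelySupercyclic (sumId B) ∧ ¬ IsUFrequentlySupercyclic (sumId B)) ∧
    -- the third inclusion is strict on `ℓ_p(ℕ) ⊕ ℂ` for every `1 ≤ p < ∞`
    (∀ (p : ENNReal) [Fact (1 ≤ p)], p ≠ ⊤ →
      ∃ (w : ℕ → ℝ) (B : ellP p →L[ℂ] ellP p), IsWeight w ∧ IsBackwardShiftEllP w B ∧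
        IsSupercyclic (sumId B) ∧ ¬ IsReiterativelySupercyclic (sumId B)) := by
  refine ⟨fun X _ _ _ => ⟨fun _ h => h.isUFrequentlySupercyclic,
    fun _ h => h.isReiterativelySupercyclic, fun _ h => h.isSupercyclic⟩,
    exists_isUFrequentlySupercyclic_not_isFrequentlySupercyclic,
    exists_isReiterativelySupercyclic_not_isUFrequentlySupercyclic,
    fun p _ hp => exists_isSupercyclic_not_isReiterativelySupercyclic p hp⟩
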